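/- Let $Y$ be a complex manifold (Hausdorff, second countable, of complex dimension $n$), equipped with a smooth positive measure $\mu$, that is, a Borel measure which in local coordinates has a smooth, strictly positive density with respect to Lebesgue measure. Let $D\subseteq Y$ be a precompact domain, i.e. a (nonempty) connected open set with compact closure $\overline D$, and assume that $D$ is smoothly bounded: there are an open neighborhood $V$ of the boundary $bD$ and $\rho\in C^\infty(V;\mathbb{R})$ such that $d\rho\neq 0$ at every point of $bD$ and $D\cap V=\{z\in V:\rho(z)<0\}$. Let $\mathcal{O}(D)$ be the space of holomorphic functions on $D$, and let $B_{D,\mu}:L^2(D,\mu)\to\mathcal{O}(D)\cap L^2(D,\mu)$ be the weighted Bergman projection, i.e. the orthogonal projection of $L^2(D,\mu)$ onto its closed subspace $\mathcal{O}(D)\cap L^2(D,\mu)$. Assume that the algebra $A(D):=C(\overline D)\cap\mathcal{O}(D)$ of continuous functions on $\overline D$ that are holomorphic on $D$ has a boundary peak point: there are $z_0\in bD$ and $F\in A(D)$ such that $F(z_0)=1$ and $|F(z)|<1$ for every $z\in\overline D\setminus\{z_0\}$. Then $B_{D,\mu}$ admits no bounded extension to $L^1(D,\mu)$: there is no bounded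 linear operator $T$ on $L^1(D,\mu)$ with $Tf=B_{D,\mu}f$ for every $f\in L^1(D,\mu)\cap L^2(D,\mu)$. -/

import Mathlib

open MeasureTheory Set Filter Topology Metric
open scoped Manifold ContDiff

/-- The model space `ℂⁿ`. -/
abbrev CSpace (n : ℕ) : Type := EuclideanSpace ℂ (Fin n)

section Definitions

variable (n : ℕ) {Y : Type*} [TopologicalSpace Y] [ChartedSpace (CSpace n) Y]

/-- `f` is holomorphic on the subset `D` (open, in all uses) of the `n`-dimensional complex
manifold `Y`. -/
def IsHolomorphicOn (f : Y → ℂ) (D : Set Y) : Prop :=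
  MDifferentiableOn 𝓘(ℂ, CSpace n) 𝓘(ℂ, ℂ) f D

/-- `μ` is a smooth positive measure: in every chart `e` it is `w · dλ`, where `λ` is Lebesgue
measure and `w` is a positive function that is smooth in the real sense. -/
def IsSmoothPositiveMeasure [MeasurableSpace Y] (μ : Measure Y) : Prop :=
  ∀ e ∈ atlas (CSpace n) Y, ∃ w : CSpace n → ℝ,
    ContDiffOn ℝ ∞ w e.target ∧ (∀ x ∈ e.target, 0 < w x) ∧
    μ.restrict e.source =
      ((volume.restrict e.target).withDensity fun x => ENNReal.ofReal (w x)).map e.symm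

/-- `D` is smoothly bounded: there are an open neighbourhood `V` of the boundary of `D` and a real
function `ρ`, smooth on `V` (in the real sense), with `dρ ≠ 0` at every boundary point of `D` and
`D ∩ V = {ρ < 0}`. -/
def IsSmoothlyBounded (D : Set Y) : Prop :=
  ∃ (V : Set Y) (ρ : Y → ℝ), IsOpen V ∧ frontier D ⊆ V ∧
    ContMDiffOn 𝓘(ℝ, CSpace n) 𝓘(ℝ, ℝ) ∞ ρ V ∧
    (∀ x ∈ frontier D, mfderiv 𝓘(ℝ, CSpace n) 𝓘(ℝ, ℝ) ρ x ≠ 0) ∧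
    D ∩ V = {x ∈ V | ρ x < 0}

/-- The algebra `A(D) = C(closure D) ∩ O(D)` of continuous functions on the closure of `D` whose
restriction to `D` is holomorphic. -/
def holomorphicAlgebra (D : Set Y) : Subalgebra ℂ C(closure D, ℂ) where
  carrier := {F | ∃ f : Y → ℂ, IsHolomorphicOn n f D ∧ ∀ z : closure D, (z : Y) ∈ D → F z = f z}
  mul_mem' := by
    rintro F G ⟨f, hf, hFf⟩ ⟨g, hg, hGg⟩
    refine ⟨fun z => f z * g z, ?_, fun z hz => by simp [hFf z hz, hGg z hz]⟩
    exact fun z hz => (hf z hz).mul (hg z hz)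
  add_mem' := by
    rintro F G ⟨f, hf, hFf⟩ ⟨g, hg, hGg⟩
    refine ⟨fun z => f z + g z, ?_, fun z hz => by simp [hFf z hz, hGg z hz]⟩
    exact fun z hz => (hf z hz).add (hg z hz)
  algebraMap_mem' := fun c => ⟨fun _ => c, mdifferentiableOn_const, fun _ _ => rfl⟩

/-- The weighted Bergman space `O(D) ∩ L²(D, μ)`, as a subspace of `L²(D, μ)`. -/
def bergmanSpace [MeasurableSpace Y] (μ : Measure Y) (D : Set Y) :
    Submodule ℂ (Lp ℂ 2 (μ.restrict D)) where
  carrier := {f | ∃ g : Y → ℂ, IsHolomorphicOn n g D ∧ f =ᵐ[μ.restrict D] g}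
  add_mem' := by
    rintro F G ⟨f, hf, hFf⟩ ⟨g, hg, hGg⟩
    exact ⟨f + g, fun z hz => (hf z hz).add (hg z hz), (Lp.coeFn_add F G).trans (hFf.add hGg)⟩
  zero_mem' := ⟨fun _ => 0, mdifferentiableOn_const, Lp.coeFn_zero ℂ 2 _⟩
  smul_mem' := by
    rintro c F ⟨f, hf, hFf⟩
    exact ⟨c • f, fun z hz => (hf z hz).const_smul c,
      (Lp.coeFn_smul c F).trans (hFf.const_smul c)⟩

end Definitions

/-! The weighted Bergman space is closed in `L²(D, μ)`; the next helper facts prove this, because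
the definition of the orthogonal projection needs it. -/

theorem enorm_le_lintegral_ball {n : ℕ} {h : EuclideanSpace ℂ (Fin n) → ℂ}
    {U : Set (EuclideanSpace ℂ (Fin n))} (hh : DifferentiableOn ℂ h U)
    {z : EuclideanSpace ℂ (Fin n)} {r : ℝ} (hz : ball z r ⊆ U) :
    volume (ball (0 : EuclideanSpace ℂ (Fin n)) r) * ‖h z‖ₑ ≤ ∫⁻ v in ball z r, ‖h v‖ₑ := by
  set B := ball (0 : EuclideanSpace ℂ (Fin n)) r with hB
  set J := Ioc (0 : ℝ) (2 * Real.pi) with hJ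
  have hmem : ∀ (c : ℂ), ‖c‖ = 1 → ∀ v ∈ B, z + c • v ∈ ball z r := by
    intro c hc v hv
    simp only [hB, mem_ball, dist_zero_right] at hv
    simp [norm_smul, hc, hv]
  -- the mean value inequality on complex lines
  have h1 : ∀ v ∈ B, volume J * ‖h z‖ₑ ≤ ∫⁻ θ in J, ‖h (z + circleMap 0 1 θ • v)‖ₑ := by
    intro v hv
    have hd : DifferentiableOn ℂ (fun c : ℂ => h (z + c • v)) (closedBall 0 1) := by
      refine hh.comp (by fun_prop) ?_
      intro c hc
      refine hz ?_
      simp only [hB, mem_ball, dist_zero_right, mem_closedBall] at hv hc ⊢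
      simp only [dist_self_add_left, norm_smul]
      nlinarith [norm_nonneg v, norm_nonneg c]
    have h2 : Real.circleAverage (fun c : ℂ => h (z + c • v)) 0 1 = h z := by
      have h3 : DiffContOnCl ℂ (fun c : ℂ => h (z + c • v)) (ball 0 |1|) := by
        rw [abs_one]
        exact hd.diffContOnCl_ball Subset.rfl
      simpa using h3.circleAverage
    have hpi : (0 : ℝ) ≤ 2 * Real.pi := by positivity
    rw [Real.circleAverage, intervalIntegral.integral_of_le hpi] at h2
    have h3 : (∫ θ in J, h (z + circleMap 0 1 θ • v)) = (2 * Real.pi : ℝ) • h z := by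
      rw [← h2, smul_inv_smul₀ (by positivity)]
    calc volume J * ‖h z‖ₑ = ‖(2 * Real.pi : ℝ) • h z‖ₑ := by
          rw [enorm_smul, Real.enorm_of_nonneg hpi]; simp [hJ]
      _ ≤ _ := by rw [← h3]; exact enorm_integral_le_lintegral_enorm _
  -- rotation invariance
  have h2 : ∀ θ : ℝ, ∫⁻ v in B, ‖h (z + circleMap 0 1 θ • v)‖ₑ = ∫⁻ v in ball z r, ‖h v‖ₑ := by
    intro θ
    have hc : ‖circleMap 0 1 θ‖ = 1 := by simp
    have hc0 : circleMap 0 1 θ ≠ 0 := by intro h0; simp [h0] at hc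
    let L : EuclideanSpace ℂ (Fin n) ≃ₗᵢ[ℝ] EuclideanSpace ℂ (Fin n) :=
      { (LinearEquiv.smulOfNeZero ℂ (EuclideanSpace ℂ (Fin n)) _ hc0).restrictScalars ℝ with
        norm_map' := fun v => by
          change ‖circleMap 0 1 θ • v‖ = ‖v‖
          rw [norm_smul, hc, one_mul] }
    have hL : MeasurePreserving (fun v => z + L v) volume volume :=
      (measurePreserving_add_left volume z).comp L.measurePreserving
    have hLe : MeasurableEmbedding (fun v => z + L v) :=
      ((MeasurableEquiv.addLeft z).measurableEmbedding).comp
        L.toHomeomorph.measurableEmbedding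
    have hpre : (fun v => z + L v) ⁻¹' (ball z r) = B := by
      ext v; simp [hB]
    rw [← hpre]
    exact hL.setLIntegral_comp_preimage_emb hLe (fun w => ‖h w‖ₑ) (ball z r)
  have hmeas : AEMeasurable (fun q : EuclideanSpace ℂ (Fin n) × ℝ =>
      ‖h (z + circleMap 0 1 q.2 • q.1)‖ₑ) ((volume.restrict B).prod (volume.restrict J)) := by
    rw [Measure.prod_restrict]
    refine ContinuousOn.aemeasurable ?_ (measurableSet_ball.prod measurableSet_Ioc)
    refine continuous_enorm.comp_continuousOn (hh.continuousOn.comp ?_ ?_)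
    · have : Continuous fun θ : ℝ => circleMap 0 1 θ := continuous_circleMap 0 1
      fun_prop
    · rintro ⟨v, θ⟩ hq
      exact hz (hmem _ (by simp) v hq.1)
  have hJ0 : volume J ≠ 0 := by simp [hJ, Real.pi_pos]
  have hJt : volume J ≠ ⊤ := by simp [hJ, ENNReal.mul_eq_top]
  have key : volume J * (volume B * ‖h z‖ₑ) ≤ volume J * ∫⁻ v in ball z r, ‖h v‖ₑ := by
    calc volume J * (volume B * ‖h z‖ₑ) = ∫⁻ _ in B, volume J * ‖h z‖ₑ := by
          rw [setLIntegral_const]; ring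
      _ ≤ ∫⁻ v in B, ∫⁻ θ in J, ‖h (z + circleMap 0 1 θ • v)‖ₑ :=
          setLIntegral_mono' measurableSet_ball h1
      _ = ∫⁻ θ in J, ∫⁻ v in B, ‖h (z + circleMap 0 1 θ • v)‖ₑ := lintegral_lintegral_swap hmeas
      _ = volume J * ∫⁻ v in ball z r, ‖h v‖ₑ := by
          simp_rw [h2]; rw [setLIntegral_const]; ring
  exact (ENNReal.mul_le_mul_iff_right hJ0 hJt).1 key

/-- Uniform limits of holomorphic functions of several variables are holomorphic. -/
theorem differentiableAt_of_tendstoUniformlyOn_ball {n : ℕ} {F : ℕ → EuclideanSpace ℂ (Fin n) → ℂ}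
    {G : EuclideanSpace ℂ (Fin n) → ℂ} {a : EuclideanSpace ℂ (Fin n)} {r : ℝ} (hr : 0 < r)
    (hF : ∀ k, DifferentiableOn ℂ (F k) (ball a r))
    (hFG : TendstoUniformlyOn F G atTop (ball a r)) : DifferentiableAt ℂ G a := by
  have hsub : ball a (r / 2) ⊆ ball a r := ball_subset_ball (by linarith)
  have hder : ∀ k, ∀ x ∈ ball a r, HasFDerivAt (F k) (fderiv ℂ (F k) x) x := fun k x hx =>
    ((hF k).differentiableAt (isOpen_ball.mem_nhds hx)).hasFDerivAt
  have hcau := hFG.uniformCauchySeqOn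
  have hC : UniformCauchySeqOn (fun k => fderiv ℂ (F k)) atTop (ball a (r / 2)) := by
    rw [Metric.uniformCauchySeqOn_iff] at hcau ⊢
    intro ε hε
    obtain ⟨N, hN⟩ := hcau (ε * (r / 4) / 2) (by positivity)
    refine ⟨N, fun k hk l hl x hx => ?_⟩
    rw [dist_eq_norm]
    refine lt_of_le_of_lt (ContinuousLinearMap.opNorm_le_bound _ (by positivity : 0 ≤ ε / 2) ?_)
      (half_lt_self hε)
    intro v
    by_cases hv : v = 0
    · simp [hv]
    have hv' : 0 < ‖v‖ := norm_pos_iff.2 hv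
    set R := r / 4 / ‖v‖ with hR
    have hR0 : 0 < R := by positivity
    have hball : ∀ c : ℂ, c ∈ closedBall (0 : ℂ) R → x + c • v ∈ ball a r := by
      intro c hc
      rw [mem_closedBall, dist_zero_right] at hc
      rw [mem_ball, dist_eq_norm] at hx ⊢
      have : ‖c • v‖ ≤ r / 4 := by
        rw [norm_smul]
        calc ‖c‖ * ‖v‖ ≤ R * ‖v‖ := by gcongr
          _ = r / 4 := by rw [hR]; field_simp
      calc ‖x + c • v - a‖ = ‖(x - a) + c • v‖ := by congr 1; abel
        _ ≤ ‖x - a‖ + ‖c • v‖ := norm_add_le _ _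
        _ < r := by linarith
    let φ : ℂ → ℂ := fun c => F k (x + c • v) - F l (x + c • v)
    have hφd : DifferentiableOn ℂ φ (closedBall 0 R) := by
      have hl : DifferentiableOn ℂ (fun c : ℂ => x + c • v) (closedBall 0 R) := by fun_prop
      exact ((hF k).comp hl hball).sub ((hF l).comp hl hball)
    have hder0 : HasDerivAt φ ((fderiv ℂ (F k) x - fderiv ℂ (F l) x) v) 0 := by
      have hline : HasDerivAt (fun c : ℂ => x + c • v) v 0 := by
        simpa using ((hasDerivAt_id (0 : ℂ)).smul_const v).const_add x
      have hk' := (hder k (x + (0 : ℂ) • v) (by simpa using hsub hx)).comp_hasDerivAt 0 hline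
      have hl' := (hder l (x + (0 : ℂ) • v) (by simpa using hsub hx)).comp_hasDerivAt 0 hline
      simpa using! hk'.sub hl'
    have := Complex.norm_deriv_le_of_forall_mem_sphere_norm_le hR0
      (hφd.diffContOnCl_ball Subset.rfl) (C := ε * (r / 4) / 2) (fun c hc => by
        have := hN k hk l hl _ (hball c (sphere_subset_closedBall hc))
        rw [dist_eq_norm] at this
        exact this.le)
    rw [hder0.deriv] at this
    refine this.trans (le_of_eq ?_)
    rw [hR]; field_simp
  have hlim : ∀ x ∈ ball a (r / 2), ∃ A, Tendsto (fun k => fderiv ℂ (F k) x) atTop (𝓝 A) :=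
    fun x hx => cauchySeq_tendsto_of_complete (hC.cauchySeq hx)
  choose! A hA using hlim
  have hT : TendstoUniformlyOn (fun k => fderiv ℂ (F k)) A atTop (ball a (r / 2)) :=
    hC.tendstoUniformlyOn_of_tendsto hA
  exact (hasFDerivAt_of_tendstoUniformlyOn isOpen_ball hT (fun k x hx => hder k x (hsub hx))
    (fun x hx => hFG.tendsto_at (hsub hx)) (mem_ball_self (by positivity))).differentiableAt

section Projection

variable {n : ℕ} {Y : Type*} [TopologicalSpace Y] [ChartedSpace (CSpace n) Y]
  [IsManifold 𝓘(ℂ, CSpace n) ω Y] [MeasurableSpace Y] [BorelSpace Y]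

theorem IsHolomorphicOn.exists_enorm_sq_le {μ : Measure Y} (hμ : IsSmoothPositiveMeasure n μ)
    {D : Set Y} (hD : IsOpen D) {p : Y} (hp : p ∈ D) :
    ∃ r > 0, ∃ C : NNReal, ball (chartAt (CSpace n) p p) r ⊆
        (chartAt (CSpace n) p).target ∩ (chartAt (CSpace n) p).symm ⁻¹' D ∧
      ∀ g : Y → ℂ, IsHolomorphicOn n g D →
        DifferentiableOn ℂ (g ∘ (chartAt (CSpace n) p).symm) (ball (chartAt (CSpace n) p p) r) ∧
        ∀ y ∈ ball (chartAt (CSpace n) p p) r,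
          ‖g ((chartAt (CSpace n) p).symm y)‖ₑ ^ 2 ≤ C * ∫⁻ x in D, ‖g x‖ₑ ^ 2 ∂μ := by
  set e := chartAt (CSpace n) p with he
  have hpe : p ∈ e.source := mem_chart_source _ p
  obtain ⟨w, hw, hw0, hμw⟩ := hμ e (chart_mem_atlas _ p)
  set U := e.target ∩ e.symm ⁻¹' D with hU
  have hUo : IsOpen U := e.symm.isOpen_inter_preimage hD
  have hpt : e p ∈ e.target := e.map_source hpe
  have hpU : e p ∈ U := ⟨hpt, by simpa [e.left_inv hpe] using hp⟩
  set c := w (e p) / 2 with hc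
  have hc0 : 0 < c := half_pos (hw0 _ hpt)
  have hev : ∀ᶠ y in 𝓝 (e p), y ∈ U ∧ c < w y := by
    refine Filter.Eventually.and (hUo.mem_nhds hpU) ?_
    exact ((hw.continuousOn.continuousAt (e.open_target.mem_nhds hpt)).eventually
      (lt_mem_nhds (half_lt_self (hw0 _ hpt))))
  obtain ⟨R, hR, hRU⟩ := Metric.eventually_nhds_iff_ball.1 hev
  set r := R / 2 with hr
  have hr0 : 0 < r := half_pos hR
  set v0 := volume (ball (0 : CSpace n) r) with hv0
  have hv00 : v0 ≠ 0 := (measure_ball_pos _ _ hr0).ne'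
  have hv0t : v0 ≠ ⊤ := measure_ball_lt_top.ne
  refine ⟨r, hr0, (v0⁻¹ * (ENNReal.ofReal c)⁻¹).toNNReal, ?_, ?_⟩
  · exact fun y hy => (hRU y (ball_subset_ball (by linarith) hy)).1
  intro g hg
  have hgU : DifferentiableOn ℂ (g ∘ e.symm) U := by
    rw [← mdifferentiableOn_iff_differentiableOn]
    exact MDifferentiableOn.comp hg
      ((mdifferentiableOn_atlas_symm (I := 𝓘(ℂ, CSpace n)) (chart_mem_atlas _ p)).mono
        inter_subset_left) inter_subset_right
  refine ⟨hgU.mono fun y hy => (hRU y (ball_subset_ball (by linarith) hy)).1, ?_⟩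
  intro y hy
  have hyR : ball y r ⊆ ball (e p) R := by
    refine ball_subset_ball' ?_
    rw [mem_ball] at hy; linarith
  have hyU : ball y r ⊆ U := fun x hx => (hRU x (hyR hx)).1
  have h1 := enorm_le_lintegral_ball (hgU.pow 2) hyU
  simp only [Pi.pow_apply, Function.comp_apply, enorm_pow] at h1
  have h2 : ENNReal.ofReal c * ∫⁻ v in ball y r, ‖g (e.symm v)‖ₑ ^ 2 ≤
      ∫⁻ x in D, ‖g x‖ₑ ^ 2 ∂μ := by
    have hsm : MeasurableSet (e.source ∩ D) := (e.open_source.inter hD).measurableSet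
    have hmeas : AEMeasurable (fun x => ‖g x‖ₑ ^ 2) (μ.restrict D) := by
      refine AEMeasurable.pow_const ?_ _
      exact (continuous_enorm.comp_continuousOn hg.continuousOn).aemeasurable hD.measurableSet
    have hsymm : AEMeasurable e.symm ((volume.restrict e.target).withDensity
        fun x => ENNReal.ofReal (w x)) :=
      (e.continuousOn_symm.aemeasurable e.open_target.measurableSet).mono_ac
        (withDensity_absolutelyContinuous _ _)
    have hwm : AEMeasurable (fun x => ENNReal.ofReal (w x)) (volume.restrict U) :=
      ((hw.continuousOn.mono inter_subset_left).aemeasurable hUo.measurableSet).ennreal_ofReal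
    have hgm : AEMeasurable (fun v => ‖g (e.symm v)‖ₑ ^ 2) (volume.restrict U) :=
      ((continuous_enorm.comp_continuousOn hgU.continuousOn).aemeasurable
        hUo.measurableSet).pow_const 2
    have hset : μ.restrict (e.source ∩ D) = ((volume.restrict U).withDensity
        fun x => ENNReal.ofReal (w x)).map e.symm := by
      rw [inter_comm, ← Measure.restrict_restrict hD.measurableSet, hμw,
        Measure.restrict_map_of_aemeasurable hsymm hD.measurableSet]
      congr 1
      rw [restrict_withDensity', Measure.restrict_restrict' e.open_target.measurableSet,
        inter_comm]
    calc ENNReal.ofReal c * ∫⁻ v in ball y r, ‖g (e.symm v)‖ₑ ^ 2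
        = ∫⁻ v in ball y r, ENNReal.ofReal c * ‖g (e.symm v)‖ₑ ^ 2 :=
          (lintegral_const_mul' _ _ ENNReal.ofReal_ne_top).symm
      _ ≤ ∫⁻ v in ball y r, ENNReal.ofReal (w v) * ‖g (e.symm v)‖ₑ ^ 2 := by
          refine setLIntegral_mono' measurableSet_ball fun v hv => ?_
          gcongr
          exact (hRU v (hyR hv)).2.le
      _ ≤ ∫⁻ v in U, ENNReal.ofReal (w v) * ‖g (e.symm v)‖ₑ ^ 2 := lintegral_mono_set hyU
      _ = ∫⁻ x in e.source ∩ D, ‖g x‖ₑ ^ 2 ∂μ := by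
          rw [hset, lintegral_map', lintegral_withDensity_eq_lintegral_mul₀ hwm]
          · rfl
          · exact hgm
          · rw [← hset]
            exact hmeas.mono_measure (Measure.restrict_mono_set _ inter_subset_right)
          · exact ((e.continuousOn_symm.mono inter_subset_left).aemeasurable
              hUo.measurableSet).mono_ac (withDensity_absolutelyContinuous _ _)
      _ ≤ ∫⁻ x in D, ‖g x‖ₑ ^ 2 ∂μ := lintegral_mono_set inter_subset_right
  have hcE : ENNReal.ofReal c ≠ 0 := by simpa using hc0
  rw [ENNReal.coe_toNNReal (ENNReal.mul_ne_top (ENNReal.inv_ne_top.2 hv00)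
    (ENNReal.inv_ne_top.2 hcE)), mul_assoc, ← ENNReal.div_eq_inv_mul, ← ENNReal.div_eq_inv_mul,
    ENNReal.le_div_iff_mul_le (Or.inl hv00) (Or.inl hv0t), 
    ENNReal.le_div_iff_mul_le (Or.inl hcE) (Or.inl ENNReal.ofReal_ne_top), mul_comm,
    mul_comm _ v0]
  exact (mul_le_mul_right h1 _).trans h2

theorem isClosed_bergmanSpace {μ : Measure Y} (hμ : IsSmoothPositiveMeasure n μ) {D : Set Y}
    (hD : IsOpen D) : IsClosed (bergmanSpace n μ D : Set (Lp ℂ 2 (μ.restrict D))) := by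
  refine isSeqClosed_iff_isClosed.1 ?_
  intro F f hF hFf
  choose g hg hFg using hF
  have hnorm : ∀ k l, ∫⁻ x in D, ‖(g k - g l) x‖ₑ ^ 2 ∂μ = ‖F k - F l‖ₑ ^ 2 := by
    intro k l
    have key : ∀ φ : Y → ℂ,
        eLpNorm φ 2 (μ.restrict D) ^ 2 = ∫⁻ x in D, ‖φ x‖ₑ ^ 2 ∂μ := by
      intro φ
      have h1 := eLpNorm_nnreal_pow_eq_lintegral (f := φ) (μ := μ.restrict D) (p := 2) two_ne_zero
      norm_num at h1
      exact h1
    rw [Lp.enorm_def, key]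
    refine lintegral_congr_ae ?_
    filter_upwards [Lp.coeFn_sub (F k) (F l), hFg k, hFg l] with x h1 h2 h3
    rw [h1, Pi.sub_apply, Pi.sub_apply, h2, h3]
  have hcau : ∀ p ∈ D, ∃ r > 0, ball (chartAt (CSpace n) p p) r ⊆
      (chartAt (CSpace n) p).target ∩ (chartAt (CSpace n) p).symm ⁻¹' D ∧
      (∀ k, DifferentiableOn ℂ (g k ∘ (chartAt (CSpace n) p).symm)
        (ball (chartAt (CSpace n) p p) r)) ∧
      UniformCauchySeqOn (fun k => g k ∘ (chartAt (CSpace n) p).symm) atTop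
        (ball (chartAt (CSpace n) p p) r) := by
    intro p hp
    obtain ⟨r, hr, C, hsub, hC⟩ := IsHolomorphicOn.exists_enorm_sq_le hμ hD hp
    refine ⟨r, hr, hsub, fun k => (hC _ (hg k)).1, ?_⟩
    rw [Metric.uniformCauchySeqOn_iff]
    intro ε hε
    obtain ⟨N, hN⟩ := Metric.cauchySeq_iff.1 hFf.cauchySeq (ε / (C + 1)) (by positivity)
    refine ⟨N, fun k hk l hl y hy => ?_⟩
    have h1 := (hC (g k - g l) fun z hz => (hg k z hz).sub (hg l z hz)).2 y hy
    rw [hnorm] at h1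
    have h2 := hN k hk l hl
    rw [dist_eq_norm] at h2 ⊢
    have h3 : ‖(g k - g l) ((chartAt (CSpace n) p).symm y)‖ ^ 2 ≤ C * ‖F k - F l‖ ^ 2 := by
      have := ENNReal.toReal_mono (by finiteness) h1
      simpa using this
    have h4 : ‖F k - F l‖ * (C + 1) < ε := (lt_div_iff₀ (by positivity)).1 h2
    change ‖(g k - g l) ((chartAt (CSpace n) p).symm y)‖ < ε
    refine lt_of_le_of_lt (abs_le_of_sq_le_sq' (b := ‖F k - F l‖ * (C + 1)) ?_ (by positivity)).2 h4
    have hC0 : (0 : ℝ) ≤ C := C.2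
    refine h3.trans ?_
    rw [mul_pow, mul_comm]
    gcongr
    nlinarith
  have hpt : ∀ x ∈ D, ∃ a, Tendsto (fun k => g k x) atTop (𝓝 a) := by
    intro p hp
    obtain ⟨r, hr, -, -, hu⟩ := hcau p hp
    have := cauchySeq_tendsto_of_complete (hu.cauchySeq (mem_ball_self hr))
    simpa using this
  choose! G hG using hpt
  refine ⟨G, ?_, ?_⟩
  · intro p hp
    obtain ⟨r, hr, hsub, hd, hu⟩ := hcau p hp
    have hT := hu.tendstoUniformlyOn_of_tendsto (f := G ∘ (chartAt (CSpace n) p).symm)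
      fun y hy => hG _ (hsub hy).2
    have hdiff := differentiableAt_of_tendstoUniformlyOn_ball hr hd hT
    have hps := mem_chart_source (CSpace n) p
    have h1 : MDifferentiableAt 𝓘(ℂ, CSpace n) 𝓘(ℂ, ℂ)
        ((G ∘ (chartAt (CSpace n) p).symm) ∘ chartAt (CSpace n) p) p :=
      MDifferentiableAt.comp p hdiff.mdifferentiableAt
        (mdifferentiableAt_atlas (chart_mem_atlas _ p) hps)
    refine (h1.congr_of_eventuallyEq ?_).mdifferentiableWithinAt
    filter_upwards [(chartAt (CSpace n) p).open_source.mem_nhds hps] with x hx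
    simp [(chartAt (CSpace n) p).left_inv hx]
  · obtain ⟨ns, hns, hae⟩ := (tendstoInMeasure_of_tendsto_Lp hFf).exists_seq_tendsto_ae
    filter_upwards [hae, ae_all_iff.2 hFg, ae_restrict_mem hD.measurableSet] with x h1 h2 hx
    refine tendsto_nhds_unique h1 ?_
    simp_rw [h2]
    exact (hG x hx).comp hns.tendsto_atTop

/-- The Bergman projection `B_{D,μ}`: the orthogonal projection of `L²(D, μ)` onto the weighted
Bergman space, as an operator on `L²(D, μ)`. -/
noncomputable def bergmanProjection {μ : Measure Y} (hμ : IsSmoothPositiveMeasure n μ) {D : Set Y}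
    (hD : IsOpen D) : Lp ℂ 2 (μ.restrict D) →L[ℂ] Lp ℂ 2 (μ.restrict D) :=
  haveI : CompleteSpace (bergmanSpace n μ D) :=
    (isClosed_bergmanSpace hμ hD).completeSpace_coe
  (bergmanSpace n μ D).starProjection

end Projection

/-- The operator `B` on `L²(ν)` extends to a bounded operator on `L¹(ν)`: some bounded linear
operator on `L¹(ν)` agrees with `B` on `L¹(ν) ∩ L²(ν)`. -/
def HasBoundedExtensionToL1 {X : Type*} [MeasurableSpace X] {ν : Measure X}
    (B : Lp ℂ 2 ν →L[ℂ] Lp ℂ 2 ν) : Prop :=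
  ∃ T : Lp ℂ 1 ν →L[ℂ] Lp ℂ 1 ν, ∀ (f : Lp ℂ 2 ν) (f' : Lp ℂ 1 ν),
    f' =ᵐ[ν] f → T f' =ᵐ[ν] B f

/-! Suppose that the Bergman projection B extends to L¹ with norm C. Since B is self-adjoint,
duality gives |⟨g, Bf⟩| ≤ C ‖f‖_∞ ‖g‖₁ for bounded f
(`HasBoundedExtensionToL1.exists_norm_inner_le`). The peak function F contradicts this, for the same
reason that harmonic conjugation is unbounded in the sup norm on the disc.

Take a polynomial p with p(0) = 0, |Re p| ≤ 3 on the closed unit disc and p(1) huge; truncations of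
i log(1 - rt) provide it. The function u = p(F^k) lies in the Bergman space, so Bu = u, while u +
conj u = 2 Re p(F^k) is bounded by 6. If B almost annihilates conj u, then B(u + conj u) is almost
u, which is close to p(1) near the peak point z₀. Testing against the indicator of a small set near
z₀ gives the contradiction (`not_hasBoundedExtensionToL1_starProjection`).

That B almost annihilates conj(F^j) for large j comes from a bounded function q, continuous at z₀
with q(z₀) = 1, whose product with every integrable holomorphic function has integral 0 over D
(`IsSmoothlyBounded.exists_setIntegral_mul_eq_zero`). Then B(conj(F^j q)) = 0, so B(conj(F^j)) =
B(conj(F^j (1 - q))). Moreover F^j (1 - q) tends to 0 uniformly: 1 - q is small near z₀, and |F|^j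
decays uniformly away from z₀.

In a chart, q is a Cauchy-Riemann derivative of ρψ divided by the density of μ, with ψ a test
function. Stokes' theorem has no boundary term because ρψ vanishes on the boundary
(`setIntegral_mul_dbar_mul_eq_zero`). At z₀ the derivative falls on ρ alone and is nonzero in a
suitable direction because dρ ≠ 0; ψ is normalized accordingly. -/

/-! ### Polynomials with bounded real part and a large value at 1 -/

/-- There are polynomials vanishing at `0` whose real part is bounded by a fixed constant on the
closed unit disc, but which take arbitrarily large values at `1`. -/
theorem exists_polynomial_re_le_norm_ge (A : ℝ) : ∃ (N : ℕ) (a : ℕ → ℂ), a 0 = 0 ∧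
    (∀ t : ℂ, ‖t‖ ≤ 1 → |(∑ j ∈ Finset.range N, a j * t ^ j).re| ≤ 3) ∧
    A ≤ ‖∑ j ∈ Finset.range N, a j‖ := by
  -- Chosen so that log(1 - r) = -(|A| + 1); the extra 1 pays for truncating the Taylor series.
  set r : ℝ := 1 - Real.exp (-(|A| + 1)) with hr
  have hr1 : r < 1 := by have := Real.exp_pos (-(|A| + 1)); linarith
  have hr0 : 0 < r := by
    have : Real.exp (-(|A| + 1)) < 1 := Real.exp_lt_one_iff.2 (by have := abs_nonneg A; linarith)
    linarith
  obtain ⟨n, hn⟩ : ∃ n : ℕ, r ^ (n + 1) * (1 - r)⁻¹ / (n + 1) < 1 := by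
    have h1 : Tendsto (fun n : ℕ => r ^ (n + 1) * (1 - r)⁻¹) atTop (𝓝 (0 * (1 - r)⁻¹)) :=
      ((tendsto_pow_atTop_nhds_zero_of_lt_one hr0.le hr1).comp (tendsto_add_atTop_nat 1)).mul_const _
    rw [zero_mul] at h1
    obtain ⟨n, hn⟩ := (h1.eventually (gt_mem_nhds one_pos)).exists
    refine ⟨n, lt_of_le_of_lt (div_le_self ?_ ?_) hn⟩
    · have : 0 < 1 - r := by linarith
      positivity
    · have : (0 : ℝ) ≤ n := by positivity
      linarith
  have key : ∀ t : ℂ, ‖t‖ ≤ 1 →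
      ‖Complex.log (1 + -(r * t)) - Complex.logTaylor (n + 1) (-(r * t))‖ < 1 := by
    intro t ht
    have hz : ‖-(r * t : ℂ)‖ ≤ r := by
      rw [norm_neg, norm_mul, Complex.norm_real, Real.norm_of_nonneg hr0.le]
      nlinarith
    refine (Complex.norm_log_sub_logTaylor_le n (hz.trans_lt hr1)).trans_lt (lt_of_le_of_lt ?_ hn)
    have h1 : 0 < 1 - r := by linarith
    have h2 : 0 < 1 - ‖-(r * t : ℂ)‖ := by linarith
    gcongr
  have hsum : ∀ t : ℂ, ∑ j ∈ Finset.range (n + 1),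
      (Complex.I * ((-1) ^ (j + 1) * (-r) ^ j / j)) * t ^ j =
        Complex.I * Complex.logTaylor (n + 1) (-(r * t)) := by
    intro t
    rw [Complex.logTaylor, Finset.mul_sum]
    refine Finset.sum_congr rfl fun j _ => ?_
    rw [← neg_mul, mul_pow]; ring
  -- These are the coefficients of i times the Taylor polynomial of log(1 - rt). For j = 0 the
  -- division by zero returns 0, which is the required constant term.
  refine ⟨n + 1, fun j => Complex.I * ((-1) ^ (j + 1) * (-r) ^ j / j), by simp, ?_, ?_⟩
  · intro t ht
    rw [hsum t]
    have h1 := key t ht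
    -- The point 1 - rt stays in the right half-plane, so Im log is at most π/2 in absolute value.
    -- The factor i turns this into a bound on the real part, and π/2 + 1 < 3.
    have h2 : |(Complex.log (1 + -(r * t))).im| ≤ Real.pi / 2 := by
      rw [Complex.log_im, Complex.abs_arg_le_pi_div_two_iff]
      have := (Complex.abs_re_le_norm (r * t : ℂ)).trans (b := ‖(r * t : ℂ)‖) le_rfl
      rw [norm_mul, Complex.norm_real, Real.norm_of_nonneg hr0.le] at this
      have h3 := (abs_le.1 this).2
      simp only [Complex.add_re, Complex.one_re, Complex.neg_re]
      nlinarith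
    have h3 := (Complex.abs_im_le_norm _).trans h1.le
    rw [Complex.sub_im] at h3
    have hpi := Real.pi_lt_d2
    rw [Complex.I_mul_re, abs_neg]
    rw [abs_le] at *
    constructor <;> linarith [h2.1, h2.2, h3.1, h3.2]
  · have h1 := key 1 (by simp)
    have h2 := hsum 1
    simp only [one_pow, mul_one] at h1 h2
    rw [h2, norm_mul, Complex.norm_I, one_mul]
    have h3 : ‖Complex.log (1 + -(r : ℂ))‖ = |A| + 1 := by
      have : (1 + -(r : ℂ)) = ((Real.exp (-(|A| + 1)) : ℝ) : ℂ) := by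
        rw [hr]; push_cast; ring
      rw [this, ← Complex.ofReal_log (Real.exp_pos _).le, Real.log_exp, Complex.norm_real,
        Real.norm_eq_abs, abs_neg, abs_of_nonneg (by positivity)]
    have h4 := norm_sub_norm_le (Complex.log (1 + -(r : ℂ))) (Complex.logTaylor (n + 1) (-r))
    have := le_abs_self A
    linarith

/-! ### Duality and the abstract contradiction from a peak function -/

section Functional

variable {X : Type*} [MeasurableSpace X] {ν : Measure X} [IsFiniteMeasure ν]
  {K : Submodule ℂ (Lp ℂ 2 ν)} [K.HasOrthogonalProjection]

/-- By duality, an orthogonal projection that is bounded on `L¹` is bounded on `L^∞`. -/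
theorem HasBoundedExtensionToL1.exists_norm_inner_le
    (h : HasBoundedExtensionToL1 K.starProjection) :
    ∃ C : ℝ, 0 ≤ C ∧ ∀ (f g : Lp ℂ 2 ν) (M : ℝ), (∀ᵐ x ∂ν, ‖f x‖ ≤ M) →
      ‖inner ℂ g (K.starProjection f)‖ ≤ C * M * ∫ x, ‖g x‖ ∂ν := by
  obtain ⟨T, hT⟩ := h
  refine ⟨‖T‖, norm_nonneg _, fun f g M hM => ?_⟩
  have hg1 : MemLp g 1 ν := (Lp.memLp g).mono_exponent one_le_two
  have hTg := hT g (hg1.toLp g) hg1.coeFn_toLp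
  -- Self-adjointness moves the projection onto g, where it agrees with the L¹ operator.
  rw [← Submodule.inner_starProjection_left_eq_right, L2.inner_def]
  calc ‖∫ x, inner ℂ (K.starProjection g x) (f x) ∂ν‖
      ≤ ∫ x, M * ‖T (hg1.toLp g) x‖ ∂ν := by
        refine norm_integral_le_of_norm_le ((L1.integrable_coeFn _).norm.const_mul M) ?_
        filter_upwards [hM, hTg] with x h1 h2
        rw [h2, mul_comm]
        exact (norm_inner_le_norm _ _).trans (by gcongr)
    _ = M * ‖T (hg1.toLp g)‖ := by rw [integral_const_mul, L1.norm_eq_integral_norm]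
    _ ≤ _ := by
        have h1 : ‖hg1.toLp g‖ = ∫ x, ‖g x‖ ∂ν := by
          rw [L1.norm_eq_integral_norm]
          refine integral_congr_ae ?_
          filter_upwards [hg1.coeFn_toLp] with x hx
          rw [hx]
        -- For the zero measure M may be negative, so the estimate by the operator norm needs a
        -- separate case.
        by_cases hν : ν = 0
        · subst hν
          have : T (hg1.toLp g) = 0 := by
            rw [← norm_eq_zero, L1.norm_eq_integral_norm]; simp
          simp [this]
        · have hM0 : 0 ≤ M := by
            have : NeBot (ae ν) := ae_neBot.2 hν
            obtain ⟨x, hx⟩ := hM.exists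
            exact (norm_nonneg _).trans hx
          rw [← h1]
          calc M * ‖T (hg1.toLp g)‖ ≤ M * (‖T‖ * ‖hg1.toLp g‖) := by
                gcongr; exact T.le_opNorm _
            _ = _ := by ring

/-- If `F` is in the unit ball of `L^∞`, its powers lie in `K`, `F` is arbitrarily close to `1` on
sets of positive measure, and multiplication of `conj (F ^ k)` by a function tending to `0` where
`|F|` tends to `1` does not change the projection to `K`, then the projection is not bounded on
`L¹`. -/
theorem not_hasBoundedExtensionToL1_starProjection {F q : X → ℂ}
    (hFm : AEStronglyMeasurable F ν) (hF1 : ∀ᵐ x ∂ν, ‖F x‖ ≤ 1)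
    (hqm : AEStronglyMeasurable q ν) {M : ℝ} (hqM : ∀ᵐ x ∂ν, ‖q x‖ ≤ M)
    (hFK : ∀ (k : ℕ) (u : Lp ℂ 2 ν), u =ᵐ[ν] (fun x => F x ^ k) → u ∈ K)
    (hq : ∀ (k : ℕ), ∀ u ∈ K, ∫ x, u x * F x ^ k * q x ∂ν = 0)
    (hsmall : ∀ ε > 0, ∀ᶠ k : ℕ in atTop, ∀ᵐ x ∂ν, ‖F x ^ k * (1 - q x)‖ ≤ ε)
    (hpeak : ∀ ε > 0, ∃ S, MeasurableSet S ∧ ν S ≠ 0 ∧ ∀ x ∈ S, ‖F x - 1‖ < ε) :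
    ¬ HasBoundedExtensionToL1 K.starProjection := by
  intro hext
  obtain ⟨C, hC0, hC⟩ := hext.exists_norm_inner_le
  have hFk : ∀ k : ℕ, MemLp (fun x => F x ^ k) 2 ν := fun k =>
    MemLp.of_bound (hFm.pow k) 1 (hF1.mono fun x hx => by
      rw [norm_pow]; exact pow_le_one₀ (norm_nonneg _) hx)
  have hFkc : ∀ k : ℕ, MemLp (fun x => star (F x ^ k)) 2 ν := fun k => (hFk k).star
  have hFq : ∀ k : ℕ, MemLp (fun x => star (F x ^ k * q x)) 2 ν := fun k => by
    refine MemLp.star (MemLp.of_bound ((hFm.pow k).mul hqm) M ?_)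
    filter_upwards [hF1, hqM] with x h1 h2
    rw [norm_mul, norm_pow]
    have h3 : ‖F x‖ ^ k ≤ 1 := pow_le_one₀ (norm_nonneg _) h1
    nlinarith [norm_nonneg (q x)]
  set e : ℕ → Lp ℂ 2 ν := fun k => (hFk k).toLp _ with he
  set ec : ℕ → Lp ℂ 2 ν := fun k => (hFkc k).toLp _ with hec
  -- The inner product with u ∈ K is the conjugate of ∫ u F^k q, which vanishes by hypothesis.
  have hortho : ∀ k, K.starProjection ((hFq k).toLp _) = 0 := by
    intro k
    rw [Submodule.starProjection_apply_eq_zero_iff, Submodule.mem_orthogonal]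
    intro u hu
    rw [L2.inner_def, ← star_eq_zero, ← starRingEnd_apply, ← integral_conj, ← hq k u hu]
    refine integral_congr_ae ?_
    filter_upwards [(hFq k).coeFn_toLp] with x hx
    rw [hx]
    simp
    ring
  have hsmall' : ∀ ε > 0, ∀ᶠ k : ℕ in atTop, ∀ g : Lp ℂ 2 ν,
      ‖inner ℂ g (K.starProjection (ec k))‖ ≤ C * ε * ∫ x, ‖g x‖ ∂ν := by
    intro ε hε
    filter_upwards [hsmall ε hε] with k hk g
    have : K.starProjection (ec k) = K.starProjection (ec k - (hFq k).toLp _) := by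
      rw [map_sub, hortho k, sub_zero]
    rw [this]
    refine hC _ _ _ ?_
    filter_upwards [Lp.coeFn_sub (ec k) ((hFq k).toLp _), (hFkc k).coeFn_toLp,
      (hFq k).coeFn_toLp, hk] with x h1 h2 h3 h4
    rw [h1, Pi.sub_apply, h2, h3, ← star_sub, norm_star]
    rwa [mul_sub, mul_one] at h4
  -- The final comparison, per unit of mass of S: the pairing with u is at least (6C + 3) - 1, but
  -- at most 6C from the sup bound plus 1 from the projected conjugate.
  obtain ⟨N, a, ha0, hare, hanorm⟩ := exists_polynomial_re_le_norm_ge (6 * C + 3)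
  set σ := ∑ j ∈ Finset.range N, ‖a j‖ with hσ
  have hσ0 : 0 ≤ σ := Finset.sum_nonneg fun _ _ => norm_nonneg _
  -- Makes C σ δ ≤ 1, so that the conjugate terms, weighted by their coefficients, contribute at
  -- most the mass of S.
  set δ : ℝ := 1 / (C * σ + 1) with hδ
  have hδ0 : 0 < δ := by positivity
  -- The smallness is needed for all l ≥ k at once: the exponents in p(F^k) are k * j, and each is
  -- at least k when j ≥ 1. The term j = 0 is absent since a 0 = 0.
  obtain ⟨k, hk⟩ : ∃ k : ℕ, ∀ l ≥ k, ∀ g : Lp ℂ 2 ν,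
      ‖inner ℂ g (K.starProjection (ec l))‖ ≤ C * δ * ∫ x, ‖g x‖ ∂ν := by
    exact eventually_atTop.1 (hsmall' δ hδ0)
  -- a set on which `p (F ^ k)` is close to `p 1`
  obtain ⟨S, hSm, hS0, hS⟩ : ∃ S, MeasurableSet S ∧ ν S ≠ 0 ∧ ∀ x ∈ S,
      ‖∑ j ∈ Finset.range N, a j * F x ^ (k * j) - ∑ j ∈ Finset.range N, a j‖ < 1 := by
    have hcont : Continuous fun t : ℂ => ∑ j ∈ Finset.range N, a j * t ^ (k * j) := by fun_prop
    obtain ⟨η, hη, hη'⟩ := Metric.continuous_iff.1 hcont 1 1 one_pos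
    obtain ⟨S, hSm, hS0, hS⟩ := hpeak η hη
    refine ⟨S, hSm, hS0, fun x hx => ?_⟩
    have := hη' (F x) (by rw [dist_eq_norm]; exact hS x hx)
    simpa [dist_eq_norm] using this
  have hSt : ν S ≠ ⊤ := measure_ne_top _ _
  set s := ν.real S with hs
  have hs0 : 0 < s := ENNReal.toReal_pos hS0 hSt
  set g : Lp ℂ 2 ν := indicatorConstLp 2 hSm hSt (1 : ℂ) with hg
  have hgint : ∫ x, ‖g x‖ ∂ν = s := by
    have : (fun x => ‖g x‖) =ᵐ[ν] S.indicator fun _ => (1 : ℝ) := by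
      filter_upwards [indicatorConstLp_coeFn (p := 2) (hs := hSm) (hμs := hSt) (c := (1 : ℂ))]
        with x hx
      rw [hg, hx]
      by_cases hxS : x ∈ S <;> simp [hxS]
    rw [integral_congr_ae this, integral_indicator hSm]
    simp [hs]
  set u : Lp ℂ 2 ν := ∑ j ∈ Finset.range N, a j • e (k * j) with hu
  set uc : Lp ℂ 2 ν := ∑ j ∈ Finset.range N, star (a j) • ec (k * j) with huc
  have hu' : u =ᵐ[ν] fun x => ∑ j ∈ Finset.range N, a j * F x ^ (k * j) := by
    have h1 : ∀ j, (a j • e (k * j) : Lp ℂ 2 ν) =ᵐ[ν] fun x => a j * F x ^ (k * j) := fun j => by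
      filter_upwards [Lp.coeFn_smul (a j) (e (k * j)), (hFk (k * j)).coeFn_toLp] with x h1 h2
      rw [h1, Pi.smul_apply, h2, smul_eq_mul]
    filter_upwards [Lp.coeFn_finsetSum (Finset.range N) fun j => a j • e (k * j), ae_all_iff.2 h1]
      with x h2 h3
    rw [hu, h2]
    simp [h3]
  have huc' : uc =ᵐ[ν] fun x => star (∑ j ∈ Finset.range N, a j * F x ^ (k * j)) := by
    have h1 : ∀ j, (star (a j) • ec (k * j) : Lp ℂ 2 ν) =ᵐ[ν]
        fun x => star (a j * F x ^ (k * j)) := fun j => by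
      filter_upwards [Lp.coeFn_smul (star (a j)) (ec (k * j)), (hFkc (k * j)).coeFn_toLp]
        with x h1 h2
      rw [h1, Pi.smul_apply, h2, smul_eq_mul, star_mul']
    filter_upwards [Lp.coeFn_finsetSum (Finset.range N) fun j => star (a j) • ec (k * j),
      ae_all_iff.2 h1] with x h2 h3
    rw [huc, h2, star_sum, Finset.sum_apply]
    exact Finset.sum_congr rfl fun j _ => h3 j
  -- The sum is 2 Re p(F^k), hence at most 2 · 3.
  have hbound : ∀ᵐ x ∂ν, ‖(u + uc) x‖ ≤ 6 := by
    filter_upwards [Lp.coeFn_add u uc, hu', huc', hF1] with x h1 h2 h3 h4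
    have h5 := hare (F x ^ k) (by rw [norm_pow]; exact pow_le_one₀ (norm_nonneg _) h4)
    simp_rw [← pow_mul] at h5
    rw [h1, Pi.add_apply, h2, h3, ← starRingEnd_apply, Complex.add_conj, Complex.norm_real,
      Real.norm_eq_abs, abs_mul, abs_two]
    linarith
  have hPu : K.starProjection u = u :=
    Submodule.starProjection_eq_self_iff.2 <| Submodule.sum_mem _ fun j _ =>
      K.smul_mem _ (hFK _ _ (hFk (k * j)).coeFn_toLp)
  have h1 := hC (u + uc) g 6 hbound
  rw [map_add, hPu, inner_add_right, hgint] at h1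
  have h2 : ‖inner ℂ g (K.starProjection uc)‖ ≤ s := by
    rw [huc, map_sum, inner_sum]
    calc ‖∑ j ∈ Finset.range N, inner ℂ g (K.starProjection (star (a j) • ec (k * j)))‖
        ≤ ∑ j ∈ Finset.range N, ‖a j‖ * (C * δ * s) := by
          refine norm_sum_le_of_le _ fun j _ => ?_
          rw [map_smul, inner_smul_right, norm_mul, norm_star]
          rcases Nat.eq_zero_or_pos j with rfl | hj
          · simp [ha0]
          · gcongr
            rw [← hgint]
            exact hk _ (Nat.le_mul_of_pos_right k hj) g
      _ = C * σ / (C * σ + 1) * s := by rw [← Finset.sum_mul, ← hσ, hδ]; ring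
      _ ≤ 1 * s := by
          gcongr
          rw [div_le_one (by positivity)]
          linarith
      _ = s := one_mul s
  have h3 : (6 * C + 2) * s ≤ ‖inner ℂ g u‖ := by
    rw [hg, L2.inner_indicatorConstLp_one hSm hSt, setIntegral_congr_ae hSm (hu'.mono fun x hx _ => hx)]
    have hpint : IntegrableOn (fun x => ∑ j ∈ Finset.range N, a j * F x ^ (k * j)) S ν :=
      (((Lp.memLp u).integrable one_le_two).congr hu').integrableOn
    have h4 : ‖∫ x in S, ((∑ j ∈ Finset.range N, a j * F x ^ (k * j)) -
        ∑ j ∈ Finset.range N, a j) ∂ν‖ ≤ 1 * s :=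
      norm_setIntegral_le_of_norm_le_const hSt.lt_top fun x hx => (hS x hx).le
    rw [integral_sub hpint (integrable_const _), setIntegral_const] at h4
    have h5 := norm_sub_norm_le (ν.real S • ∑ j ∈ Finset.range N, a j)
      (∫ x in S, (∑ j ∈ Finset.range N, a j * F x ^ (k * j)) ∂ν)
    rw [norm_sub_rev] at h5
    rw [norm_smul, Real.norm_of_nonneg measureReal_nonneg] at h5
    nlinarith
  have h4 := norm_sub_le (inner ℂ g u + inner ℂ g (K.starProjection uc))
    (inner ℂ g (K.starProjection uc))
  rw [add_sub_cancel_right] at h4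
  nlinarith

end Functional

/-! ### Cauchy-Riemann derivatives and integration by parts -/

section Dbar

variable {E : Type*} [NormedAddCommGroup E] [NormedSpace ℂ E]

/-- Directional derivatives of holomorphic functions are continuous. -/
theorem DifferentiableOn.continuousOn_fderiv_apply {f : E → ℂ} {U : Set E} (hU : IsOpen U)
    (hf : DifferentiableOn ℂ f U) (v : E) : ContinuousOn (fun x => fderiv ℂ f x v) U := by
  intro a ha
  refine ContinuousAt.continuousWithinAt ?_
  have hcont : ContinuousOn (fun q : E × ℂ => f (q.1 + q.2 • v))
      {q : E × ℂ | q.1 + q.2 • v ∈ U} :=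
    hf.continuousOn.comp (by fun_prop) fun q hq => hq
  have hopen : IsOpen {q : E × ℂ | q.1 + q.2 • v ∈ U} := hU.preimage (by fun_prop)
  have hmem : ((a, 0) : E × ℂ) ∈ {q : E × ℂ | q.1 + q.2 • v ∈ U} := by simpa using ha
  obtain ⟨s, hs, t, ht, hst⟩ := mem_nhds_prod_iff.1 (hopen.mem_nhds hmem)
  obtain ⟨r, hr, hrt⟩ := Metric.mem_nhds_iff.1 ht
  -- On the complex line through x in direction v, f is a one-variable holomorphic function of ζ.
  -- These functions converge locally uniformly as x → a, hence so do their ζ-derivatives, by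
  -- Weierstrass.
  have hunif : TendstoLocallyUniformlyOn (fun x (ζ : ℂ) => f (x + ζ • v)) (fun ζ => f (a + ζ • v))
      (𝓝 a) (ball 0 r) := by
    rw [tendstoLocallyUniformlyOn_iff_forall_tendsto]
    intro ζ hζ
    have hz : ((a, ζ) : E × ℂ) ∈ {q : E × ℂ | q.1 + q.2 • v ∈ U} :=
      hst ⟨mem_of_mem_nhds hs, hrt hζ⟩
    have h1 := (hcont.continuousAt (hopen.mem_nhds hz)).tendsto
    have h2 : Tendsto (fun q : E × ℂ => f (a + q.2 • v)) (𝓝 a ×ˢ 𝓝[ball 0 r] ζ)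
        (𝓝 (f (a + ζ • v))) := by
      have h3 : ContinuousAt (fun z : ℂ => f (a + z • v)) ζ := by
        have := ContinuousAt.comp (f := fun z : ℂ => (a, z)) (x := ζ)
          (hcont.continuousAt (hopen.mem_nhds hz)) (by fun_prop)
        exact this
      exact (h3.tendsto.mono_left nhdsWithin_le_nhds).comp tendsto_snd
    have h4 : Tendsto (fun q : E × ℂ => f (q.1 + q.2 • v)) (𝓝 a ×ˢ 𝓝[ball 0 r] ζ)
        (𝓝 (f (a + ζ • v))) := by
      refine h1.mono_left ?_
      rw [nhds_prod_eq]
      exact Filter.prod_mono le_rfl nhdsWithin_le_nhds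
    exact (h2.prodMk_nhds h4).mono_right (nhds_prod_eq.le.trans (by
      rw [← nhds_prod_eq]; exact nhds_le_uniformity _))
  have hder := TendstoLocallyUniformlyOn.deriv hunif ?_ isOpen_ball
  · have h0 := hder.tendsto_at (mem_ball_self hr)
    have hd : ∀ x ∈ U, _root_.deriv (fun ζ : ℂ => f (x + ζ • v)) 0 = fderiv ℂ f x v := by
      intro x hx
      have hline : HasDerivAt (fun ζ : ℂ => x + ζ • v) v 0 := by
        simpa using ((hasDerivAt_id (0 : ℂ)).smul_const v).const_add x
      have h1 : HasFDerivAt f (fderiv ℂ f x) (x + (0 : ℂ) • v) := by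
        simpa using (hf.differentiableAt (hU.mem_nhds hx)).hasFDerivAt
      exact (h1.comp_hasDerivAt 0 hline).deriv
    rw [ContinuousAt, ← hd a ha]
    refine h0.congr' ?_
    filter_upwards [hU.mem_nhds ha] with x hx using hd x hx
  · filter_upwards [hs] with x hx
    exact hf.comp (by fun_prop) fun ζ hζ => hst (mk_mem_prod hx (hrt hζ))

/-- Twice the Cauchy-Riemann derivative of `g` in the direction `v`. -/
noncomputable def dbar (v : E) (g : E → ℂ) (x : E) : ℂ :=
  fderiv ℝ g x v + Complex.I * fderiv ℝ g x (Complex.I • v)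

theorem dbar_mul {g h : E → ℂ} {x : E} (v : E) (hg : DifferentiableAt ℝ g x)
    (hh : DifferentiableAt ℝ h x) :
    dbar v (fun y => g y * h y) x = dbar v g x * h x + g x * dbar v h x := by
  simp only [dbar, fderiv_fun_mul hg hh, _root_.add_apply,
    _root_.smul_apply, smul_eq_mul]
  ring

theorem dbar_ofReal_comp {η : ℝ → ℝ} {ρ : E → ℝ} {x : E} (v : E)
    (hη : DifferentiableAt ℝ η (ρ x)) (hρ : DifferentiableAt ℝ ρ x) :
    dbar v (fun y => (η (ρ y) : ℂ)) x = deriv η (ρ x) * dbar v (fun y => (ρ y : ℂ)) x := by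
  have h1 : HasFDerivAt (fun y => (ρ y : ℂ)) (Complex.ofRealCLM.comp (fderiv ℝ ρ x)) x :=
    Complex.ofRealCLM.hasFDerivAt.comp x hρ.hasFDerivAt
  have h2 : HasFDerivAt (fun y => (η (ρ y) : ℂ))
      (Complex.ofRealCLM.comp (deriv η (ρ x) • fderiv ℝ ρ x)) x :=
    Complex.ofRealCLM.hasFDerivAt.comp x (hη.hasDerivAt.comp_hasFDerivAt x hρ.hasFDerivAt)
  simp only [dbar, h1.fderiv, h2.fderiv]
  simp
  ring

theorem ContDiff.continuous_dbar {g : E → ℂ} (hg : ContDiff ℝ 1 g) (v : E) :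
    Continuous (dbar v g) := by
  have := hg.continuous_fderiv one_ne_zero
  unfold dbar
  fun_prop

theorem dbar_eq_zero_of_notMem_tsupport {g : E → ℂ} {x : E} (v : E) (hx : x ∉ tsupport g) :
    dbar v g x = 0 := by
  have : fderiv ℝ g x = 0 := by
    by_contra h
    exact hx (support_fderiv_subset ℝ h)
  simp [dbar, this]

/-- For real ρ the real part of `dbar v ρ` is dρ(v), so any v not killed by dρ works. -/
theorem exists_dbar_ofReal_ne_zero {ρ : E → ℝ} {x : E} (hρ : DifferentiableAt ℝ ρ x)
    (h : fderiv ℝ ρ x ≠ 0) : ∃ v, dbar v (fun y => (ρ y : ℂ)) x ≠ 0 := by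
  obtain ⟨v, hv⟩ := DFunLike.ne_iff.1 h
  refine ⟨v, fun h0 => hv ?_⟩
  have h1 : HasFDerivAt (fun y => (ρ y : ℂ)) (Complex.ofRealCLM.comp (fderiv ℝ ρ x)) x :=
    Complex.ofRealCLM.hasFDerivAt.comp x hρ.hasFDerivAt
  simpa [dbar, h1.fderiv] using congrArg Complex.re h0

theorem ContinuousOn.continuous_mul_of_tsupport_subset {X : Type*} [TopologicalSpace X]
    {f φ : X → ℂ} {U : Set X} (hU : IsOpen U) (hf : ContinuousOn f U) (hφ : Continuous φ)
    (h : tsupport φ ⊆ U) : Continuous fun x => f x * φ x :=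
  continuous_of_tsupport fun _ hx =>
    (hf.continuousAt (hU.mem_nhds (h (tsupport_mul_subset_right hx)))).mul hφ.continuousAt

variable [FiniteDimensional ℂ E] [MeasurableSpace E] [BorelSpace E] {m : Measure E}
  [m.IsAddHaarMeasure]

/-- Holomorphic functions are orthogonal to Cauchy-Riemann derivatives of test functions. -/
theorem integral_mul_dbar_eq_zero {f φ : E → ℂ} {U : Set E} (hU : IsOpen U)
    (hf : DifferentiableOn ℂ f U) (hφ : ContDiff ℝ 1 φ) (hc : HasCompactSupport φ)
    (hsupp : tsupport φ ⊆ U) (v : E) : ∫ x, f x * dbar v φ x ∂m = 0 := by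
  have : FiniteDimensional ℝ E := FiniteDimensional.complexToReal E
  have hfd : ∀ x ∈ U, HasFDerivAt f ((fderiv ℂ f x).restrictScalars ℝ) x := fun x hx =>
    (hf.differentiableAt (hU.mem_nhds hx)).hasFDerivAt.restrictScalars ℝ
  have hfd' : ∀ x ∈ U, ∀ u, fderiv ℝ f x u = fderiv ℂ f x u := fun x hx u => by
    rw [(hfd x hx).fderiv]; rfl
  have hi : ∀ u, Integrable (fun x => fderiv ℝ f x u * φ x) m := fun u =>
    (((hf.continuousOn_fderiv_apply hU u).congr fun x hx => hfd' x hx u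
      ).continuous_mul_of_tsupport_subset hU hφ.continuous hsupp).integrable_of_hasCompactSupport
      hc.mul_left
  have hi' : ∀ u, Integrable (fun x => f x * fderiv ℝ φ x u) m := fun u => by
    have hs : tsupport (fun x => fderiv ℝ φ x u) ⊆ tsupport φ := by
      refine closure_minimal (fun x hx => ?_) isClosed_closure
      exact support_fderiv_subset ℝ (f := φ) fun h => hx (by simp [h])
    refine (hf.continuousOn.continuous_mul_of_tsupport_subset hU ?_
      (hs.trans hsupp)).integrable_of_hasCompactSupport ?_
    · exact (hφ.continuous_fderiv one_ne_zero).clm_apply continuous_const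
    · exact HasCompactSupport.mul_left (hc.of_isClosed_subset isClosed_closure hs)
  have hi0 : Integrable (fun x => f x * φ x) m :=
    (hf.continuousOn.continuous_mul_of_tsupport_subset hU hφ.continuous
      hsupp).integrable_of_hasCompactSupport hc.mul_left
  have key : ∀ u, ∫ x, f x * fderiv ℝ φ x u ∂m = -∫ x, fderiv ℝ f x u * φ x ∂m := fun u =>
    integral_mul_fderiv_eq_neg_fderiv_mul_of_integrable (hi u) (hi' u) hi0
      (fun x hx => (hfd x (hsupp hx)).differentiableAt)
      (fun x _ => (hφ.differentiable one_ne_zero).differentiableAt)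
  have h1 : ∀ x, f x * dbar v φ x =
      f x * fderiv ℝ φ x v + Complex.I * (f x * fderiv ℝ φ x (Complex.I • v)) := fun x => by
    rw [dbar]; ring
  simp_rw [h1]
  rw [integral_add (hi' v) ((hi' _).const_mul _), integral_const_mul, key, key, mul_neg, ← neg_add,
    ← integral_const_mul, ← integral_add (hi v) ((hi _).const_mul _), neg_eq_zero]
  refine integral_eq_zero_of_ae (Eventually.of_forall fun x => ?_)
  -- On U complex linearity gives f'(iv) = i f'(v), so the two terms cancel; off U the test function
  -- vanishes.
  by_cases hx : x ∈ U
  · simp only [hfd' x hx, map_smul, smul_eq_mul, Pi.zero_apply]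
    linear_combination (fderiv ℂ f x v * φ x) * Complex.I_mul_I
  · have : φ x = 0 := image_eq_zero_of_notMem_tsupport fun h => hx (hsupp h)
    simp [this]

/-! ### Stokes' theorem without boundary regularity of the holomorphic function -/

/-- A smooth truncation of the identity on the negative half-line. -/
theorem exists_contDiff_truncation : ∃ (θ : ℝ → ℝ) (C : ℝ), ContDiff ℝ 1 θ ∧
    (∀ t, -1 ≤ t → θ t = 0) ∧ (∀ t ≤ -2, θ t = t) ∧ (∀ t, |deriv θ t| ≤ C) ∧
    ∀ t, |θ t| ≤ |t| := by
  set θ : ℝ → ℝ := fun t => t * Real.smoothTransition (-1 - t) with hθ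
  have hsm : ContDiff ℝ 1 θ :=
    contDiff_id.mul (Real.smoothTransition.contDiff.comp (contDiff_const.sub contDiff_id))
  have h0 : ∀ t, -1 ≤ t → θ t = 0 := fun t ht => by
    simp [hθ, Real.smoothTransition.zero_of_nonpos (by linarith : -1 - t ≤ 0)]
  have h1 : ∀ t ≤ -2, θ t = t := fun t ht => by
    simp [hθ, Real.smoothTransition.one_of_one_le (by linarith : 1 ≤ -1 - t)]
  have hcont : Continuous (deriv θ) := hsm.continuous_deriv le_rfl
  obtain ⟨C, hC⟩ := (isCompact_Icc (a := (-2 : ℝ)) (b := -1)).exists_bound_of_continuousOn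
    hcont.continuousOn
  refine ⟨θ, max C 1, hsm, h0, h1, fun t => ?_, fun t => ?_⟩
  · rcases lt_or_ge t (-2) with ht | ht
    · have : θ =ᶠ[𝓝 t] id := by
        filter_upwards [gt_mem_nhds ht] with s hs using h1 s hs.le
      rw [this.deriv_eq]; simp
    rcases lt_or_ge (-1) t with ht' | ht'
    · have : θ =ᶠ[𝓝 t] fun _ => 0 := by
        filter_upwards [lt_mem_nhds ht'] with s hs using h0 s hs.le
      rw [this.deriv_eq]; simp
    · exact (hC t ⟨ht, ht'⟩).trans (le_max_left _ _)
  · rw [hθ, abs_mul, abs_of_nonneg (Real.smoothTransition.nonneg _)]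
    exact mul_le_of_le_one_right (abs_nonneg _) (Real.smoothTransition.le_one _)

/-- Stokes' theorem for an integrable holomorphic function `f` on `{ρ < 0}` and a form vanishing on
`{ρ = 0}`. -/
theorem setIntegral_mul_dbar_mul_eq_zero {ρ : E → ℝ} (hρ : ContDiff ℝ 1 ρ) {f ψ : E → ℂ}
    {B W : Set E} (hB : IsOpen B) (hψ : ContDiff ℝ 1 ψ) (hc : HasCompactSupport ψ)
    (hsupp : tsupport ψ ⊆ B) (hW : IsOpen W) (hf : DifferentiableOn ℂ f W)
    (hBW : B ∩ {x | ρ x < 0} ⊆ W) (hfi : IntegrableOn f (B ∩ {x | ρ x < 0}) m) (v : E) :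
    ∫ x in B ∩ {x | ρ x < 0},
      f x * (dbar v (fun y => (ρ y : ℂ)) x * ψ x + ρ x * dbar v ψ x) ∂m = 0 := by
  obtain ⟨θ, C, hθ, hθ0, hθ1, hθC, hθl⟩ := exists_contDiff_truncation
  have hC0 : 0 ≤ C := (abs_nonneg _).trans (hθC 0)
  set Ω := B ∩ {x | ρ x < 0} with hΩ
  have hΩo : IsOpen Ω := hB.inter (isOpen_lt hρ.continuous continuous_const)
  -- A rescaled truncation: η k (ρ) equals ρ where ρ ≤ -2/(k+1) and vanishes where ρ ≥ -1/(k+1).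
  -- Thus η k (ρ) ψ is a test function inside Ω, and f needs no boundary values. The rescaling
  -- leaves the bound C on the derivative independent of k.
  set η : ℕ → ℝ → ℝ := fun k t => θ ((k + 1) * t) / (k + 1) with hη
  have hηc : ∀ k, ContDiff ℝ 1 (η k) := fun k =>
    (hθ.comp (contDiff_const.mul contDiff_id)).div_const _
  have hηd : ∀ k t, deriv (η k) t = deriv θ ((k + 1) * t) := by
    intro k t
    have hk : (k + 1 : ℝ) ≠ 0 := by positivity
    have h1 : HasDerivAt (fun t : ℝ => (k + 1) * t) (k + 1 : ℝ) t := by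
      simpa using (hasDerivAt_id t).const_mul (k + 1 : ℝ)
    have h2 := (((hθ.differentiable one_ne_zero) _).hasDerivAt.comp t h1).div_const (k + 1 : ℝ)
    rw [mul_div_cancel_right₀ _ hk] at h2
    exact h2.deriv
  have hρC : ContDiff ℝ 1 fun y => (ρ y : ℂ) := Complex.ofRealCLM.contDiff.comp hρ
  have hηρC : ∀ k, ContDiff ℝ 1 fun y => (η k (ρ y) : ℂ) := fun k =>
    Complex.ofRealCLM.contDiff.comp ((hηc k).comp hρ)
  set φ : ℕ → E → ℂ := fun k y => (η k (ρ y) : ℂ) * ψ y with hφ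
  have hφd : ∀ k x, dbar v (φ k) x = deriv θ ((k + 1) * ρ x) * dbar v (fun y => (ρ y : ℂ)) x * ψ x +
      η k (ρ x) * dbar v ψ x := by
    intro k x
    rw [hφ, dbar_mul v ((hηρC k).differentiable one_ne_zero x) (hψ.differentiable one_ne_zero x),
      dbar_ofReal_comp v ((hηc k).differentiable one_ne_zero _) (hρ.differentiable one_ne_zero x),
      hηd]
  have hφsupp : ∀ k, tsupport (φ k) ⊆ Ω := by
    intro k
    have h1 : tsupport (φ k) ⊆ tsupport ψ ∩ {x | ρ x ≤ -1 / (k + 1)} := by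
      refine closure_minimal (fun x hx => ⟨?_, ?_⟩)
        ((isClosed_tsupport _).inter (isClosed_le hρ.continuous continuous_const))
      · exact subset_tsupport _ (right_ne_zero_of_mul hx)
      · by_contra hlt
        rw [mem_ofPred_eq, not_le, div_lt_iff₀ (by positivity)] at hlt
        refine hx ?_
        have : η k (ρ x) = 0 := by
          rw [hη]; simp only
          rw [hθ0 _ (by linarith), zero_div]
        simp [hφ, this]
    intro x hx
    have h2 : ρ x ≤ -1 / (k + 1) := (h1 hx).2
    refine ⟨hsupp (h1 hx).1, h2.trans_lt ?_⟩
    rw [neg_div]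
    have : (0 : ℝ) < 1 / (k + 1) := by positivity
    linarith
  have hzero : ∀ k, ∫ x in Ω, f x * dbar v (φ k) x ∂m = 0 := by
    intro k
    rw [← integral_mul_dbar_eq_zero (m := m) hW hf ((hηρC k).mul hψ)
      (hc.mul_left) ((hφsupp k).trans hBW) v]
    refine setIntegral_eq_integral_of_forall_compl_eq_zero fun x hx => ?_
    rw [dbar_eq_zero_of_notMem_tsupport v fun h => hx (hφsupp k h), mul_zero]
  -- A bound for `dbar v (φ k)` uniform in k. It is continuous with compact support, hence bounded,
  -- and f is integrable, so dominated convergence applies.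
  set bd : E → ℝ := fun x => C * ‖dbar v (fun y => (ρ y : ℂ)) x * ψ x‖ + ‖ρ x * dbar v ψ x‖ with hbd
  have hbdc : Continuous bd := by
    have h1 := hρC.continuous_dbar v
    have h2 := hψ.continuous_dbar v
    have h3 := hψ.continuous
    have h4 := hρC.continuous
    simp only [hbd]
    fun_prop
  obtain ⟨M, hM⟩ : ∃ M, ∀ x, bd x ≤ M := by
    have hcs : HasCompactSupport bd := by
      refine HasCompactSupport.intro hc fun x hx => ?_
      simp [hbd, image_eq_zero_of_notMem_tsupport hx, dbar_eq_zero_of_notMem_tsupport v hx]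
    obtain ⟨M, hM⟩ := hcs.exists_bound_of_continuous hbdc
    exact ⟨M, fun x => (le_abs_self _).trans (hM x)⟩
  have hlim : Tendsto (fun k => ∫ x in Ω, f x * dbar v (φ k) x ∂m) atTop
      (𝓝 (∫ x in Ω, f x * (dbar v (fun y => (ρ y : ℂ)) x * ψ x + ρ x * dbar v ψ x) ∂m)) := by
    refine tendsto_integral_of_dominated_convergence (fun x => ‖f x‖ * M) (fun k => ?_)
      (hfi.norm.mul_const M) (fun k => ?_) ?_
    · exact hfi.aestronglyMeasurable.mul
        (((hηρC k).mul hψ).continuous_dbar v).aestronglyMeasurable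
    · refine Eventually.of_forall fun x => ?_
      rw [norm_mul]
      gcongr
      refine le_trans ?_ (hM x)
      rw [hφd]
      refine (norm_add_le _ _).trans (add_le_add ?_ ?_)
      · rw [mul_assoc, norm_mul, Complex.norm_real, Real.norm_eq_abs]
        gcongr
        exact hθC _
      · rw [norm_mul, norm_mul, Complex.norm_real, Complex.norm_real, Real.norm_eq_abs,
          Real.norm_eq_abs]
        refine mul_le_mul_of_nonneg_right ?_ (norm_nonneg _)
        have h1 := hθl ((k + 1) * ρ x)
        have hk : (0 : ℝ) < k + 1 := by positivity
        rw [abs_mul, abs_of_pos hk] at h1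
        rw [hη]; simp only
        rw [abs_div, abs_of_pos hk, div_le_iff₀ hk]
        linarith
    · filter_upwards [ae_restrict_mem hΩo.measurableSet] with x hx
      refine tendsto_const_nhds.congr' ?_
      have hx0 : ρ x < 0 := hx.2
      obtain ⟨k₀, hk₀⟩ := exists_nat_gt (2 / -ρ x)
      rw [div_lt_iff₀ (by linarith)] at hk₀
      filter_upwards [eventually_ge_atTop k₀] with k hk
      have hkk : (k₀ : ℝ) ≤ k := by exact_mod_cast hk
      have hlt : (k + 1) * ρ x < -2 := by nlinarith
      have h1 : deriv θ ((k + 1) * ρ x) = 1 := by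
        have : θ =ᶠ[𝓝 ((k + 1) * ρ x)] id := by
          filter_upwards [gt_mem_nhds hlt] with s hs using hθ1 s hs.le
        rw [this.deriv_eq]; simp
      have h2 : η k (ρ x) = ρ x := by
        have hk : (k + 1 : ℝ) ≠ 0 := by positivity
        simp only [hη]
        rw [hθ1 _ hlt.le, mul_div_cancel_left₀ _ hk]
      rw [hφd, h1, h2]
      simp
  refine tendsto_nhds_unique hlim ?_
  simp_rw [hzero]
  exact tendsto_const_nhds

/-- Multiplication by a bump function. It lets the defining function and the density, given only
locally, be treated as globally C¹. -/
theorem ContDiffAt.exists_contDiff_eventuallyEq {F G : Type*} [NormedAddCommGroup F]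
    [NormedSpace ℝ F] [FiniteDimensional ℝ F] [NormedAddCommGroup G] [NormedSpace ℝ G]
    {g : F → G} {a : F} (hg : ContDiffAt ℝ 1 g a) :
    ∃ g' : F → G, ContDiff ℝ 1 g' ∧ g' =ᶠ[𝓝 a] g := by
  obtain ⟨ε, hε, hs⟩ := Metric.eventually_nhds_iff_ball.1 (hg.eventually (by simp))
  let χ : ContDiffBump a := ⟨ε / 4, ε / 2, by positivity, by linarith⟩
  refine ⟨fun x => χ x • g x, contDiff_iff_contDiffAt.2 fun x => ?_, ?_⟩
  · by_cases hx : x ∈ ball a ε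
    · exact χ.contDiffAt.smul (hs x hx)
    · have hx' : x ∉ tsupport χ := by
        rw [χ.tsupport_eq]
        exact fun h => hx (closedBall_subset_ball (half_lt_self hε) h)
      refine contDiffAt_const (c := (0 : G)) |>.congr_of_eventuallyEq ?_
      filter_upwards [notMem_tsupport_iff_eventuallyEq.1 hx'] with y hy
      simp [hy]
  · filter_upwards [χ.eventuallyEq_one] with x hx
    simp [hx]

/-! ### The local function orthogonal to holomorphic functions -/

/-- Near a smooth boundary point `a` of `{ρ < 0}` there is a test function with value `1` at `a`
that is orthogonal, with respect to the weight `w`, to all holomorphic functions. -/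
theorem exists_compactSupport_setIntegral_mul_eq_zero {ρ w : E → ℝ} (hρ : ContDiff ℝ 1 ρ)
    (hw : ContDiff ℝ 1 w) {a : E} {B : Set E} (hB : IsOpen B) (ha : a ∈ B) (hρa : ρ a = 0)
    (hdρ : fderiv ℝ ρ a ≠ 0) (hwB : ∀ x ∈ B, 0 < w x) :
    ∃ q : E → ℂ, Continuous q ∧ HasCompactSupport q ∧ tsupport q ⊆ B ∧ q a = 1 ∧
      ∀ (f : E → ℂ) (W : Set E), IsOpen W → DifferentiableOn ℂ f W → B ∩ {x | ρ x < 0} ⊆ W →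
        IntegrableOn f (B ∩ {x | ρ x < 0}) m →
        ∫ x in B ∩ {x | ρ x < 0}, f x * (q x * w x) ∂m = 0 := by
  have : FiniteDimensional ℝ E := FiniteDimensional.complexToReal E
  obtain ⟨v, hv⟩ := exists_dbar_ofReal_ne_zero (hρ.differentiable one_ne_zero a) hdρ
  set c := dbar v (fun y => (ρ y : ℂ)) a with hcdef
  obtain ⟨χ, hχs, hχc, hχ, -, hχ1⟩ :=
    exists_contDiff_tsupport_subset (n := 1) (hB.mem_nhds ha)
  have hρC : ContDiff ℝ 1 fun y => (ρ y : ℂ) := Complex.ofRealCLM.contDiff.comp hρ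
  -- With this normalization, the derivative of ρψ at a is (dbar ρ)(a) · w(a)/c = w(a), since ρ(a) =
  -- 0 and χ(a) = 1; dividing by w gives the value 1.
  set ψ : E → ℂ := fun x => (χ x * w x : ℝ) / c with hψdef
  have hψ : ContDiff ℝ 1 ψ := (Complex.ofRealCLM.contDiff.comp (hχ.mul hw)).div_const c
  have hψ0 : ∀ x, χ x = 0 → ψ x = 0 := fun x hx => by simp [hψdef, hx]
  have hψs : tsupport ψ ⊆ tsupport χ :=
    closure_mono fun x hx h => hx (hψ0 x h)
  have hψc : HasCompactSupport ψ := hχc.of_isClosed_subset isClosed_closure hψs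
  set η : E → ℂ := fun x => dbar v (fun y => (ρ y : ℂ)) x * ψ x + ρ x * dbar v ψ x with hη
  have hηcont : Continuous η :=
    ((hρC.continuous_dbar v).mul hψ.continuous).add (hρC.continuous.mul (hψ.continuous_dbar v))
  have hηs : tsupport η ⊆ tsupport ψ := by
    refine closure_minimal (fun x hx => ?_) isClosed_closure
    by_contra h
    exact hx (by simp [hη, image_eq_zero_of_notMem_tsupport h, dbar_eq_zero_of_notMem_tsupport v h])
  have hηc : HasCompactSupport η := hψc.of_isClosed_subset isClosed_closure hηs
  have hηB : tsupport η ⊆ B := hηs.trans (hψs.trans hχs)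
  have hwinv : ContinuousOn (fun x => ((w x)⁻¹ : ℂ)) B :=
    ContinuousOn.inv₀ (Complex.continuous_ofReal.comp hw.continuous).continuousOn
      fun x hx => by simpa using (hwB x hx).ne'
  refine ⟨fun x => (w x : ℂ)⁻¹ * η x, hwinv.continuous_mul_of_tsupport_subset hB hηcont hηB,
    hηc.mul_left, tsupport_mul_subset_right.trans hηB, ?_, fun f W hW hf hBW hfi => ?_⟩
  · have hwa : (w a : ℂ) ≠ 0 := by simpa using (hwB a ha).ne'
    simp only [hη, hψdef, hρa, hχ1, ← hcdef]
    field_simp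
    simp
  · rw [← setIntegral_mul_dbar_mul_eq_zero (m := m) hρ hB hψ hψc (hψs.trans hχs) hW hf hBW hfi v]
    refine setIntegral_congr_fun (hB.inter (isOpen_lt hρ.continuous continuous_const)).measurableSet
      fun x hx => ?_
    have hwx : (w x : ℂ) ≠ 0 := by simpa using (hwB x hx.1).ne'
    change f x * ((w x : ℂ)⁻¹ * η x * w x) = f x * η x
    field_simp

end Dbar

/-! ### Transfer to the manifold through charts -/

section Chart

variable {n : ℕ} {Y : Type*} [TopologicalSpace Y] [MeasurableSpace Y] [BorelSpace Y]

theorem restrict_source_inter_eq_map {μ : Measure Y} {e : OpenPartialHomeomorph Y (CSpace n)}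
    {w : CSpace n → ℝ} (hμw : μ.restrict e.source =
      ((volume.restrict e.target).withDensity fun x => ENNReal.ofReal (w x)).map e.symm)
    {D : Set Y} (hD : MeasurableSet D) : μ.restrict (e.source ∩ D) =
      ((volume.restrict (e.target ∩ e.symm ⁻¹' D)).withDensity
        fun x => ENNReal.ofReal (w x)).map e.symm := by
  have hsymm : AEMeasurable e.symm ((volume.restrict e.target).withDensity
      fun x => ENNReal.ofReal (w x)) :=
    (e.continuousOn_symm.aemeasurable e.open_target.measurableSet).mono_ac
      (withDensity_absolutelyContinuous _ _)
  rw [inter_comm, ← Measure.restrict_restrict hD, hμw,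
    Measure.restrict_map_of_aemeasurable hsymm hD]
  congr 1
  rw [restrict_withDensity', Measure.restrict_restrict' e.open_target.measurableSet, inter_comm]

variable [ChartedSpace (CSpace n) Y]

theorem IsSmoothPositiveMeasure.measure_ne_zero {μ : Measure Y} (hμ : IsSmoothPositiveMeasure n μ)
    {O : Set Y} (hO : IsOpen O) (hne : O.Nonempty) : μ O ≠ 0 := by
  obtain ⟨p, hp⟩ := hne
  intro h0
  set e := chartAt (CSpace n) p with he
  obtain ⟨w, hw, hw0, hμw⟩ := hμ e (chart_mem_atlas _ p)
  have hpe : p ∈ e.source := mem_chart_source _ p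
  set Ω := e.target ∩ e.symm ⁻¹' O with hΩ
  have hΩo : IsOpen Ω := e.symm.isOpen_inter_preimage hO
  have hpΩ : e p ∈ Ω := ⟨e.map_source hpe, by simpa [e.left_inv hpe] using hp⟩
  have hwm : AEMeasurable (fun x => ENNReal.ofReal (w x)) (volume.restrict Ω) :=
    ((hw.continuousOn.mono inter_subset_left).aemeasurable hΩo.measurableSet).ennreal_ofReal
  have hsymm : AEMeasurable e.symm ((volume.restrict Ω).withDensity
      fun x => ENNReal.ofReal (w x)) :=
    ((e.continuousOn_symm.mono inter_subset_left).aemeasurable hΩo.measurableSet).mono_ac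
      (withDensity_absolutelyContinuous _ _)
  have h1 : μ.restrict (e.source ∩ O) = 0 :=
    Measure.restrict_eq_zero.2 (measure_mono_null inter_subset_right h0)
  rw [restrict_source_inter_eq_map hμw hO.measurableSet, Measure.map_eq_zero_iff hsymm,
    withDensity_eq_zero_iff hwm] at h1
  have h2 : volume Ω = 0 := by
    rw [← Measure.restrict_apply_self]
    refine measure_mono_null (fun x hx => ?_)
      (measure_union_null h1 (ae_restrict_mem hΩo.measurableSet))
    left
    simpa using hw0 x hx.1
  exact (hΩo.measure_pos volume ⟨_, hpΩ⟩).ne' h2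

/-- The density is bounded on a small coordinate ball, so the measure is locally finite; compactness
does the rest. -/
theorem IsSmoothPositiveMeasure.measure_lt_top {μ : Measure Y} (hμ : IsSmoothPositiveMeasure n μ)
    {s : Set Y} (hs : IsCompact s) : μ s < ⊤ := by
  refine hs.measure_lt_top_of_nhdsWithin fun p _ => ?_
  refine Measure.FiniteAtFilter.filter_mono nhdsWithin_le_nhds ?_
  set e := chartAt (CSpace n) p with he
  obtain ⟨w, hw, hw0, hμw⟩ := hμ e (chart_mem_atlas _ p)
  have hpe : p ∈ e.source := mem_chart_source _ p
  have hpt : e p ∈ e.target := e.map_source hpe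
  obtain ⟨r, hr, hrw⟩ := Metric.eventually_nhds_iff_ball.1
    (((hw.continuousOn.continuousAt (e.open_target.mem_nhds hpt)).eventually
      (gt_mem_nhds (lt_add_one _))).and (e.open_target.mem_nhds hpt))
  set N := e.source ∩ e ⁻¹' ball (e p) r with hN
  have hNo : IsOpen N := e.isOpen_inter_preimage isOpen_ball
  refine ⟨N, hNo.mem_nhds ⟨hpe, mem_ball_self hr⟩, ?_⟩
  have hsub : e.target ∩ e.symm ⁻¹' N ⊆ ball (e p) r := by
    rintro y ⟨hy, -, hyr⟩
    rwa [mem_preimage, e.right_inv hy] at hyr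
  have hmeas : AEMeasurable e.symm ((volume.restrict (e.target ∩ e.symm ⁻¹' N)).withDensity
      fun x => ENNReal.ofReal (w x)) :=
    ((e.continuousOn_symm.mono inter_subset_left).aemeasurable
      (e.symm.isOpen_inter_preimage hNo).measurableSet).mono_ac
      (withDensity_absolutelyContinuous _ _)
  calc μ N = μ.restrict (e.source ∩ N) univ := by
        rw [Measure.restrict_apply_univ, ← inter_assoc, inter_self]
    _ = ∫⁻ x in e.target ∩ e.symm ⁻¹' N, ENNReal.ofReal (w x) := by
        rw [restrict_source_inter_eq_map hμw hNo.measurableSet,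
          Measure.map_apply_of_aemeasurable hmeas MeasurableSet.univ, preimage_univ,
          withDensity_apply _ MeasurableSet.univ, Measure.restrict_univ]
    _ ≤ ∫⁻ _ in e.target ∩ e.symm ⁻¹' N, ENNReal.ofReal (w (e p) + 1) := by
        refine setLIntegral_mono' (e.symm.isOpen_inter_preimage hNo).measurableSet fun x hx => ?_
        exact ENNReal.ofReal_le_ofReal (hrw x (hsub hx)).1.le
    _ = ENNReal.ofReal (w (e p) + 1) * volume (e.target ∩ e.symm ⁻¹' N) := setLIntegral_const _ _
    _ < ⊤ := ENNReal.mul_lt_top ENNReal.ofReal_lt_top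
        ((measure_mono hsub).trans_lt measure_ball_lt_top)

/-- Near a boundary point `p` of a smoothly bounded domain there is a test function with value `1`
at `p` that is orthogonal to all integrable holomorphic functions. -/
theorem IsSmoothlyBounded.exists_setIntegral_mul_eq_zero [IsManifold 𝓘(ℂ, CSpace n) ω Y] {μ : Measure Y}
    (hμ : IsSmoothPositiveMeasure n μ) {D : Set Y} (hD : IsOpen D) (hDs : IsSmoothlyBounded n D)
    {p : Y} (hp : p ∈ frontier D) :
    ∃ q : Y → ℂ, Measurable q ∧ (∃ M, ∀ x, ‖q x‖ ≤ M) ∧ ContinuousAt q p ∧ q p = 1 ∧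
      ∀ f : Y → ℂ, IsHolomorphicOn n f D → IntegrableOn f D μ → ∫ x in D, f x * q x ∂μ = 0 := by
  obtain ⟨V, ρ, hV, hDV, hρ, hdρ, hDρ⟩ := hDs
  set e := chartAt (CSpace n) p with he
  obtain ⟨w, hw, hw0, hμw⟩ := hμ e (chart_mem_atlas _ p)
  have hpe : p ∈ e.source := mem_chart_source _ p
  have hpt : e p ∈ e.target := e.map_source hpe
  have hpV : p ∈ V := hDV hp
  have hρp : ContMDiffAt 𝓘(ℝ, CSpace n) 𝓘(ℝ, ℝ) ∞ ρ p := hρ.contMDiffAt (hV.mem_nhds hpV)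
  -- If ρ(p) > 0, points of D near p would violate ρ < 0; if ρ(p) < 0, then p ∈ D, impossible for a
  -- boundary point of an open set.
  have hρ0 : ρ p = 0 := by
    refine le_antisymm ?_ ?_
    · by_contra! hlt
      have h1 : ∀ᶠ x in 𝓝 p, 0 < ρ x ∧ x ∈ V :=
        (hρp.continuousAt.eventually (lt_mem_nhds hlt)).and (hV.mem_nhds hpV)
      obtain ⟨x, hxρ, hxD⟩ :=
        (mem_closure_iff_frequently.1 (frontier_subset_closure hp)).and_eventually h1 |>.exists
      have h2 : x ∈ D ∩ V := ⟨hxρ, hxD.2⟩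
      rw [hDρ] at h2
      exact lt_asymm h2.2 hxD.1
    · by_contra! hlt
      have h2 : p ∈ {x ∈ V | ρ x < 0} := ⟨hpV, hlt⟩
      rw [← hDρ] at h2
      rw [hD.frontier_eq] at hp
      exact hp.2 h2.1
  have hρe : ContDiffAt ℝ 1 (ρ ∘ e.symm) (e p) := by
    have h1 := (contMDiffAt_iff.1 hρp).2
    simp only [mfld_simps] at h1
    exact (contDiffWithinAt_univ.1 h1).of_le (by simp)
  have hdρe : fderiv ℝ (ρ ∘ e.symm) (e p) ≠ 0 := by
    have h1 := hdρ p hp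
    rw [(hρp.mdifferentiableAt (by simp)).mfderiv] at h1
    simp only [mfld_simps, fderivWithin_univ] at h1
    exact h1
  obtain ⟨ρ', hρ', hρρ'⟩ := hρe.exists_contDiff_eventuallyEq
  obtain ⟨w', hw', hww'⟩ := ((hw.contDiffAt (e.open_target.mem_nhds hpt)).of_le
    (by simp : (1 : ℕ∞ω) ≤ ∞)).exists_contDiff_eventuallyEq
  -- A lower bound for the density near p, used to deduce Lebesgue integrability of f from its
  -- integrability against μ.
  set c := w (e p) / 2 with hc
  have hc0 : 0 < c := half_pos (hw0 _ hpt)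
  have hVe : e.symm ⁻¹' V ∈ 𝓝 (e p) := by
    refine (e.continuousAt_symm hpt).preimage_mem_nhds (hV.mem_nhds ?_)
    rwa [e.left_inv hpe]
  have hcw : ∀ᶠ y in 𝓝 (e p), c < w y :=
    (hw.continuousOn.continuousAt (e.open_target.mem_nhds hpt)).eventually
      (lt_mem_nhds (half_lt_self (hw0 _ hpt)))
  have hte : ∀ᶠ y in 𝓝 (e p), y ∈ e.target := e.open_target.mem_nhds hpt
  have hVe' : ∀ᶠ y in 𝓝 (e p), e.symm y ∈ V := hVe
  obtain ⟨B, hB, hBo, hpB⟩ := _root_.eventually_nhds_iff.1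
    ((hρρ'.and hww').and (hte.and (hVe'.and hcw)))
  obtain ⟨q, hqc, hqcs, hqB, hq1, hq⟩ := exists_compactSupport_setIntegral_mul_eq_zero
    (m := (volume : Measure (CSpace n))) hρ' hw' hBo hpB
    (by rw [hρρ'.eq_of_nhds, Function.comp_apply, e.left_inv hpe, hρ0])
    (by rwa [hρρ'.fderiv_eq])
    (fun y hy => by rw [(hB y hy).1.2]; exact hw0 y (hB y hy).2.1)
  obtain ⟨M, hM⟩ := hqcs.exists_bound_of_continuous hqc
  have hM0 : 0 ≤ M := (norm_nonneg _).trans (hM 0)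
  set Ω := e.target ∩ e.symm ⁻¹' D with hΩ
  have hΩo : IsOpen Ω := e.symm.isOpen_inter_preimage hD
  have hBΩ : B ∩ {y | ρ' y < 0} = B ∩ Ω := by
    ext y
    refine and_congr_right fun hy => ?_
    have hyV : e.symm y ∈ V := (hB y hy).2.2.1
    have h1 : e.symm y ∈ D ↔ ρ (e.symm y) < 0 := by
      have := congrArg (e.symm y ∈ ·) hDρ
      simpa [hyV] using this
    have h2 : ρ' y = ρ (e.symm y) := (hB y hy).1.1
    change ρ' y < 0 ↔ y ∈ e.target ∧ e.symm y ∈ D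
    rw [h1, h2]
    exact ⟨fun h => ⟨(hB y hy).2.1, h⟩, fun h => h.2⟩
  -- The local function is extended by zero outside the chart. Only measurability, boundedness and
  -- continuity at p are needed of the extension.
  have hqm : Measurable (e.source.indicator (q ∘ e)) := by
    classical
    rw [← piecewise_eq_indicator]
    exact (hqc.comp_continuousOn e.continuousOn).measurable_piecewise continuousOn_const
      e.open_source.measurableSet
  refine ⟨e.source.indicator (q ∘ e), hqm, ⟨M, fun x => ?_⟩, ?_, ?_, fun f hf hfi => ?_⟩
  · by_cases hx : x ∈ e.source <;> simp [hx, hM, hM0]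
  · refine (hqc.continuousAt.comp (e.continuousAt hpe)).congr ?_
    filter_upwards [e.open_source.mem_nhds hpe] with x hx
    simp [hx]
  · simp [hpe, hq1]
  have hfe : DifferentiableOn ℂ (f ∘ e.symm) Ω := by
    rw [← mdifferentiableOn_iff_differentiableOn]
    exact MDifferentiableOn.comp hf
      ((mdifferentiableOn_atlas_symm (I := 𝓘(ℂ, CSpace n)) (chart_mem_atlas _ p)).mono
        inter_subset_left) inter_subset_right
  have hwm : AEMeasurable (fun x => ENNReal.ofReal (w x)) (volume.restrict Ω) :=
    ((hw.continuousOn.mono inter_subset_left).aemeasurable hΩo.measurableSet).ennreal_ofReal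
  have hsymm : AEMeasurable e.symm ((volume.restrict Ω).withDensity
      fun x => ENNReal.ofReal (w x)) :=
    ((e.continuousOn_symm.mono inter_subset_left).aemeasurable hΩo.measurableSet).mono_ac
      (withDensity_absolutelyContinuous _ _)
  have hset := restrict_source_inter_eq_map hμw hD.measurableSet
  rw [← hΩ] at hset
  have hfi' : IntegrableOn (fun y => w y • f (e.symm y)) Ω := by
    have h1 : IntegrableOn f (e.source ∩ D) μ := hfi.mono_set inter_subset_right
    rw [IntegrableOn, hset] at h1
    have h2 := (integrable_map_measure h1.aestronglyMeasurable hsymm).1 h1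
    rw [integrable_withDensity_iff_integrable_smul₀' hwm (by simp)] at h2
    refine h2.congr ?_
    filter_upwards [ae_restrict_mem hΩo.measurableSet] with y hy
    rw [ENNReal.toReal_ofReal (hw0 y hy.1).le]; rfl
  have hfB : IntegrableOn (f ∘ e.symm) (B ∩ Ω) := by
    refine ((hfi'.mono_set inter_subset_right).norm.const_mul c⁻¹).mono' ?_ ?_
    · exact (hfe.continuousOn.mono inter_subset_right).aestronglyMeasurable
        (hBo.inter hΩo).measurableSet
    · filter_upwards [ae_restrict_mem (hBo.inter hΩo).measurableSet] with y hy
      have h1 : c < w y := (hB y hy.1).2.2.2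
      rw [norm_smul, Real.norm_of_nonneg (hc0.trans h1).le, Function.comp_apply]
      rw [← mul_assoc]
      refine le_mul_of_one_le_left (norm_nonneg _) ?_
      rw [← div_eq_inv_mul, one_le_div hc0]
      exact h1.le
  have h1 := hq (f ∘ e.symm) Ω hΩo hfe (hBΩ ▸ inter_subset_right) (hBΩ ▸ hfB)
  rw [hBΩ] at h1
  have hfm : AEStronglyMeasurable (fun x => f x * e.source.indicator (q ∘ e) x) (μ.restrict D) :=
    hfi.aestronglyMeasurable.mul hqm.aestronglyMeasurable
  calc ∫ x in D, f x * e.source.indicator (q ∘ e) x ∂μ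
      = ∫ x in e.source ∩ D, f x * e.source.indicator (q ∘ e) x ∂μ := by
        rw [inter_comm]
        refine setIntegral_eq_of_subset_of_forall_sdiff_eq_zero hD.measurableSet inter_subset_left
          fun x hx => ?_
        have : x ∉ e.source := fun h => hx.2 ⟨hx.1, h⟩
        simp [this]
    _ = ∫ y in Ω, (ENNReal.ofReal (w y)).toReal •
          (f (e.symm y) * e.source.indicator (q ∘ e) (e.symm y)) := by
        rw [hset, integral_map hsymm, integral_withDensity_eq_integral_toReal_smul₀ hwm (by simp)]
        rw [← hset]
        exact hfm.mono_measure (Measure.restrict_mono_set _ inter_subset_right)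
    _ = ∫ y in Ω, (f ∘ e.symm) y * (q y * w' y) := by
        refine setIntegral_congr_fun hΩo.measurableSet fun y hy => ?_
        have h2 : q y * w y = q y * w' y := by
          by_cases hyB : y ∈ B
          · rw [(hB y hyB).1.2]
          · simp [image_eq_zero_of_notMem_tsupport fun h => hyB (hqB h)]
        simp only [indicator_of_mem (e.map_target hy.1), Function.comp_apply, e.right_inv hy.1,
          ENNReal.toReal_ofReal (hw0 y hy.1).le, ← h2, Complex.real_smul]
        ring
    _ = ∫ y in B ∩ Ω, (f ∘ e.symm) y * (q y * w' y) := by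
        refine setIntegral_eq_of_subset_of_forall_sdiff_eq_zero hΩo.measurableSet inter_subset_right
          fun y hy => ?_
        have : y ∉ B := fun h => hy.2 ⟨h, hy.1⟩
        simp [image_eq_zero_of_notMem_tsupport fun h => this (hqB h)]
    _ = 0 := h1

end Chart

/-! ### The peak function meets the abstract hypotheses -/

theorem mainTheorem8 (n : ℕ) {Y : Type*} [TopologicalSpace Y] [T2Space Y]
    [SecondCountableTopology Y] [ChartedSpace (CSpace n) Y] [IsManifold 𝓘(ℂ, CSpace n) ω Y]
    [MeasurableSpace Y] [BorelSpace Y]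
    (μ : Measure Y) (hμ : IsSmoothPositiveMeasure n μ)
    (D : Set Y) (hDopen : IsOpen D) (hDconn : IsConnected D) (hDcpt : IsCompact (closure D))
    (hDsmooth : IsSmoothlyBounded n D)
    (hpeak : ∃ z₀ : closure D, (z₀ : Y) ∈ frontier D ∧ ∃ F ∈ holomorphicAlgebra n D,
      F z₀ = 1 ∧ ∀ z : closure D, z ≠ z₀ → ‖F z‖ < 1) :
    ¬ HasBoundedExtensionToL1 (bergmanProjection hμ hDopen) := by
  obtain ⟨z₀, hz₀, F, ⟨f, hf, hFf⟩, hF1, hFlt⟩ := hpeak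
  have hfin : IsFiniteMeasure (μ.restrict D) := by
    rw [isFiniteMeasure_restrict]
    exact ((measure_mono subset_closure).trans_lt (hμ.measure_lt_top hDcpt)).ne
  have : CompleteSpace (bergmanSpace n μ D) := (isClosed_bergmanSpace hμ hDopen).completeSpace_coe
  obtain ⟨q, hqm, ⟨M, hM⟩, hqc, hq1, hq⟩ :=
    hDsmooth.exists_setIntegral_mul_eq_zero hμ hDopen hz₀
  have hFle : ∀ z, ‖F z‖ ≤ 1 := fun z => by
    by_cases hz : z = z₀
    · simp [hz, hF1]
    · exact (hFlt z hz).le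
  have hDF : ∀ (x : Y) (hx : x ∈ D), f x = F ⟨x, subset_closure hx⟩ := fun x hx =>
    (hFf ⟨x, subset_closure hx⟩ hx).symm
  have hfm : AEStronglyMeasurable f (μ.restrict D) :=
    hf.continuousOn.aestronglyMeasurable hDopen.measurableSet
  have hfle : ∀ x ∈ D, ‖f x‖ ≤ 1 := fun x hx => by rw [hDF x hx]; exact hFle _
  have hfpow : ∀ k, IsHolomorphicOn n (fun x => f x ^ k) D := fun k => by
    induction k with
    | zero =>
      simp_rw [pow_zero]
      exact mdifferentiableOn_const
    | succ k ih =>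
      simp_rw [pow_succ]
      exact fun z hz => (ih z hz).mul (hf z hz)
  refine not_hasBoundedExtensionToL1_starProjection (K := bergmanSpace n μ D) hfm ?_
    hqm.aestronglyMeasurable (Eventually.of_forall hM) ?_ ?_ ?_ ?_
  · filter_upwards [ae_restrict_mem hDopen.measurableSet] with x hx using hfle x hx
  · exact fun k u hu => ⟨_, hfpow k, hu⟩
  · rintro k u ⟨g, hg, hug⟩
    have hgi : IntegrableOn g D μ := ((Lp.memLp u).integrable one_le_two).congr hug
    -- The function g f^k is again holomorphic, and integrable because |f| ≤ 1.
    rw [← hq (fun x => g x * f x ^ k) (fun z hz => (hg z hz).mul (hfpow k z hz)) ?_]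
    · refine integral_congr_ae ?_
      filter_upwards [hug] with x hx
      rw [hx]
    · refine hgi.mul_bdd (c := 1) (hfm.pow k) ?_
      filter_upwards [ae_restrict_mem hDopen.measurableSet] with x hx
      rw [norm_pow]
      exact pow_le_one₀ (norm_nonneg _) (hfle x hx)
  · intro ε hε
    have hM0 : 0 ≤ M := (norm_nonneg _).trans (hM z₀)
    obtain ⟨N, hN, hNo, hzN⟩ : ∃ N : Set Y, (∀ x ∈ N, ‖1 - q x‖ < ε) ∧ IsOpen N ∧ (z₀ : Y) ∈ N := by
      refine _root_.eventually_nhds_iff.1 ?_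
      have h1 : ContinuousAt (fun x => ‖1 - q x‖) (z₀ : Y) := (continuousAt_const.sub hqc).norm
      exact h1.eventually (gt_mem_nhds (by simpa [hq1] using hε))
    have : CompactSpace (closure D) := isCompact_iff_compactSpace.1 hDcpt
    have hKc : IsCompact ((Subtype.val : closure D → Y) ⁻¹' Nᶜ) :=
      (hNo.isClosed_compl.preimage continuous_subtype_val).isCompact
    -- Off N the compact set of remaining points misses z₀, so |F| attains a maximum below 1 there;
    -- r = 0 serves when that set is empty.
    obtain ⟨r, hr0, hr1, hr⟩ : ∃ r : ℝ, 0 ≤ r ∧ r < 1 ∧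
        ∀ z : closure D, (z : Y) ∉ N → ‖F z‖ ≤ r := by
      rcases ((Subtype.val : closure D → Y) ⁻¹' Nᶜ).eq_empty_or_nonempty with hem | hne
      · refine ⟨0, le_rfl, one_pos, fun z hz => ?_⟩
        have : z ∈ (Subtype.val : closure D → Y) ⁻¹' Nᶜ := hz
        simp [hem] at this
      · obtain ⟨z, hz, hmax⟩ := hKc.exists_isMaxOn hne F.continuous.norm.continuousOn
        refine ⟨‖F z‖, norm_nonneg _, hFlt z ?_, fun y hy => hmax hy⟩
        rintro rfl
        exact hz hzN
    have hlim : Tendsto (fun k : ℕ => r ^ k * (1 + M)) atTop (𝓝 (0 * (1 + M))) :=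
      (tendsto_pow_atTop_nhds_zero_of_lt_one hr0 hr1).mul_const _
    rw [zero_mul] at hlim
    filter_upwards [hlim.eventually (gt_mem_nhds hε)] with k hk
    filter_upwards [ae_restrict_mem hDopen.measurableSet] with x hx
    rw [norm_mul, norm_pow]
    by_cases hxN : x ∈ N
    · exact (mul_le_of_le_one_left (norm_nonneg _)
        (pow_le_one₀ (norm_nonneg _) (hfle x hx))).trans (hN x hxN).le
    · refine le_trans ?_ hk.le
      gcongr
      · rw [hDF x hx]; exact hr _ hxN
      · refine (norm_sub_le _ _).trans ?_
        rw [norm_one]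
        linarith [hM x]
  · intro ε hε
    have hOo : IsOpen (D ∩ f ⁻¹' ball 1 ε) := hf.continuousOn.isOpen_inter_preimage hDopen isOpen_ball
    -- This open set is nonempty because z₀ is a limit of points of D and F is continuous there;
    -- positivity of the density gives it positive measure.
    refine ⟨D ∩ f ⁻¹' ball 1 ε, hOo.measurableSet, ?_, fun x hx => ?_⟩
    · rw [Measure.restrict_apply hOo.measurableSet,
        inter_eq_left.2 (inter_subset_left : D ∩ f ⁻¹' ball 1 ε ⊆ D)]
      refine hμ.measure_ne_zero hOo ?_
      have h1 : F ⁻¹' ball 1 ε ∈ 𝓝 z₀ :=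
        F.continuous.continuousAt.preimage_mem_nhds (by rw [hF1]; exact ball_mem_nhds _ hε)
      obtain ⟨N, hN, hNF⟩ := (mem_nhds_subtype _ _ _).1 h1
      obtain ⟨x, hxN, hxD⟩ := mem_closure_iff_nhds.1 z₀.2 N hN
      refine ⟨x, hxD, ?_⟩
      rw [mem_preimage, hDF x hxD]
      exact hNF hxN
    · rw [← dist_eq_norm]; exact hx.2
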